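/- **Formulas.** A monotone XOR(3) formula $\varphi$ with variables $x_1,\dots,x_n$ is a conjunction of distinct clauses $(x_i\oplus x_k)$, $i<k$, in which every variable appears in at most $3$ clauses; a truth assignment satisfies the clause $(x_i\oplus x_k)$ if it gives $x_i$ and $x_k$ different values. Let $\varphi$ be such a formula with exactly $m=\frac{3n}{2}$ clauses (so every variable appears in exactly $3$ clauses). **Bisections.** A bisection of a graph $G=(V,E)$ is a partition of $V$ into two sets of at most $\lceil |V|/2\rceil$ vertices each; its value is the number of edges between the two sets. **Tracks.** Let $d_1=5.6$ and $d_2=7.2$. For $1\le i\le n$ let $p_{i,0}=(2i\,d_1,\,2(i-1)d_2)$, $p_{i,1}=((2i-1)d_1,\,(2i-1)d_2)$, $q_{i,0}=((2i-1)d_1,\,2(i-1)d_2)$ and $r_{i,0}=(2i\,d_1,\,(2i-1)d_2)$. The track $T_{i,j}$, $j\in\{0,1\}$, is the union of the halflines that start at $p_{i,j}$ and point to the left and upwards. For $i\ne k$ the tracks $T_{i,j}$ and $T_{k,\ell}$ have exactly one common point. **Crowds and gadgets.** Let $\varepsilon>0$. The horizontal (vertical) $(t,p)$-crowd is a set of $t$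 closed unit disks whose centers are equally distributed on the horizontal (vertical) segment of length $2\varepsilon$ with midpoint $p$; the $(1,p)$-crowd is the unit disk with center $p$. For a point $p=(p_x,p_y)$: - $Q_1(p)$ consists of horizontal crowds of $n^3$, $2n^6-2n^3+2$ and $n^3$ disks at the points $(p_x+0.9,p_y)$, $(p_x+2.8,p_y)$ and $(p_x+4.7,p_y)$; - $Q_2(p)$ consists of vertical crowds of $1$, $n^6$, $1$ and $n^6$ disks at the points $p$, $(p_x,p_y+1.8)$, $(p_x,p_y+3.6)$ and $(p_x,p_y+5.4)$; - $Q_3(p)$ is $Q_2(p)$ with $1.8$ replaced by $1.7$. **The graph $H_\varphi$.** Take the following gadgets: - (a) $Q_1$ at $(0,(2(i-1)+j)d_2)$ for all $1\le i\le n$ and $j\in\{0,1\}$; - (b) $Q_1(q_{i,0})$, $Q_2(r_{i,0})$, $Q_3(p_{i,0})$, $Q_3(p_{i,1})$, and $Q_1$ at $(-d_1,(2i-1)d_2)$ and at $(-2d_1,(2i-1)d_2)$, for all $1\le i\le n$; - (c) $Q_1(p)$ and $Q_2(p)$ once for each common point $p$ of two tracks $T_{i,j},T_{k,\ell}$ with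 $i\neq k$. Then, for each clause $(x_i\oplus x_k)$ of $\varphi$ and for each of the two points $p=(p_x,p_y)$ with $p\in T_{i,0}\cap T_{k,1}$ or $p\in T_{i,1}\cap T_{k,0}$, replace the $n^3$-crowd of $Q_1(p)$ at $(p_x+0.9,p_y)$ by an $(n^3-1)$-crowd at this point and a single unit disk centered at $(p_x+0.9,p_y+0.01)$, and replace the $n^6$-crowd of $Q_2(p)$ at $(p_x,p_y+1.8)$ by an $(n^6-1)$-crowd at this point and a single unit disk centered at $(p_x+0.02,p_y+1.8)$. The unit disk graph $H_\varphi$ is the intersection graph of all these disks. **Theorem.** If $\varepsilon$ is sufficiently small (below a positive absolute constant), then for every integer $k\ge 0$ there is a truth assignment that satisfies at least $k$ clauses of $\varphi$ if and only if $H_\varphi$ has a bisection of value at most $2n^4(n-1)+3n-2k$. -/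

import Mathlib

namespace XorBisection

/-! ## Monotone XOR formulas -/

/-- A monotone XOR formula in the variables `x_1, …, x_n` (indexed by `Fin n`): a conjunction of
distinct clauses `x_i ⊕ x_k` of two different, unnegated variables. As `⊕` is symmetric, each clause
is written with `i < k`. -/
structure MonotoneXor (n : ℕ) where
  clauses : Finset (Fin n × Fin n)
  fst_lt_snd : ∀ c ∈ clauses, c.1 < c.2

/-- Every variable appears in at most `d` clauses. -/
def MonotoneXor.IsXor {n : ℕ} (φ : MonotoneXor n) (d : ℕ) : Prop :=
  ∀ i : Fin n, (φ.clauses.filter fun c => c.1 = i ∨ c.2 = i).card ≤ d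

/-- The number of clauses `x_i ⊕ x_k` that are XOR-satisfied by `τ`, i.e. with `τ i ≠ τ k`. -/
def MonotoneXor.numSat {n : ℕ} (φ : MonotoneXor n) (τ : Fin n → Bool) : ℕ :=
  (φ.clauses.filter fun c => τ c.1 ≠ τ c.2).card

/-! ## Unit disk graphs and bisections -/

/-- The Euclidean plane. -/
abbrev Plane : Type := EuclideanSpace ℝ (Fin 2)

/-- The intersection graph of the closed unit disks with centers `c v`. -/
def unitDiskGraph {V : Type*} (c : V → Plane) : SimpleGraph V where
  Adj u v := u ≠ v ∧ (Metric.closedBall (c u) 1 ∩ Metric.closedBall (c v) 1).Nonempty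
  symm := ⟨fun _ _ h => ⟨h.1.symm, by rw [Set.inter_comm]; exact h.2⟩⟩
  loopless := ⟨fun _ h => h.1 rfl⟩

open Classical in
/-- The partition of the vertex set into `A` and its complement is a bisection
(a balanced 2-partition). -/
def IsBisection {V : Type*} [Fintype V] (A : Finset V) : Prop :=
  A.card ≤ ⌈(Fintype.card V : ℚ) / 2⌉₊ ∧ Aᶜ.card ≤ ⌈(Fintype.card V : ℚ) / 2⌉₊

open Classical in
/-- The number of edges with one endpoint in `A` and the other endpoint outside `A`. -/
noncomputable def cutSize {V : Type*} [Fintype V] (G : SimpleGraph V) (A : Finset V) : ℕ :=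
  (G.interedges A Aᶜ).card

/-! ## Points and tracks -/

noncomputable def d₁ : ℝ := 5.6

noncomputable def d₂ : ℝ := 7.2

/-- The index of a variable, counted from `1`. -/
def idx {n : ℕ} (i : Fin n) : ℝ := (i : ℕ) + 1

/-- The bend point `p_{i,j}`. -/
noncomputable def bendPoint {n : ℕ} (i : Fin n) (j : Fin 2) : Plane :=
  if j = 0 then !₂[2 * idx i * d₁, 2 * (idx i - 1) * d₂]
  else !₂[(2 * idx i - 1) * d₁, (2 * idx i - 1) * d₂]

/-- The auxiliary point `q_{i,0}`. -/
noncomputable def auxQ {n : ℕ} (i : Fin n) : Plane :=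
  !₂[(2 * idx i - 1) * d₁, 2 * (idx i - 1) * d₂]

/-- The auxiliary point `r_{i,0}`, at height `d₂` above the bend point `p_{i,0}`. -/
noncomputable def auxR {n : ℕ} (i : Fin n) : Plane :=
  !₂[2 * idx i * d₁, (2 * idx i - 1) * d₂]

/-- The track `T_{i,j}`: the halfline from `p_{i,j}` to the left and the halfline from `p_{i,j}`
upwards. -/
def track {n : ℕ} (i : Fin n) (j : Fin 2) : Set Plane :=
  {q | q 1 = bendPoint i j 1 ∧ q 0 ≤ bendPoint i j 0} ∪
    {q | q 0 = bendPoint i j 0 ∧ bendPoint i j 1 ≤ q 1}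

/-- The pairs of tracks `T_{i,j}`, `T_{k,l}` of different variables, ordered such that `i < k`. -/
abbrev Crossing (n : ℕ) : Type :=
  {c : (Fin n × Fin 2) × (Fin n × Fin 2) // c.1.1 < c.2.1}

/-- For `i < k`, the point where the vertical halfline of `T_{i,j}` meets the horizontal halfline
of `T_{k,l}`. -/
noncomputable def crossPoint {n : ℕ} (c : Crossing n) : Plane :=
  !₂[bendPoint c.1.1.1 c.1.1.2 0, bendPoint c.1.2.1 c.1.2.2 1]

/-- The crossing point is the unique common point of the two tracks. -/
theorem track_inter_track {n : ℕ} (c : Crossing n) :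
    track c.1.1.1 c.1.1.2 ∩ track c.1.2.1 c.1.2.2 = {crossPoint c} := by
  obtain ⟨⟨⟨i, j⟩, ⟨k, l⟩⟩, hc⟩ := c
  have h : idx i + 1 ≤ idx k := by
    have h' : (i : ℕ) + 1 ≤ (k : ℕ) := hc
    have : (((i : ℕ) + 1 : ℕ) : ℝ) ≤ ((k : ℕ) : ℝ) := by exact_mod_cast h'
    simp only [idx]
    push_cast at this
    linarith
  have hx : bendPoint i j 0 < bendPoint k l 0 := by
    fin_cases j <;> fin_cases l <;> simp [bendPoint, d₁] <;> linarith
  have hy : bendPoint i j 1 < bendPoint k l 1 := by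
    fin_cases j <;> fin_cases l <;> simp [bendPoint, d₂] <;> linarith
  ext q
  simp only [track, crossPoint, Set.mem_inter_iff, Set.mem_union, Set.mem_ofPred_eq,
    Set.mem_singleton_iff]
  constructor
  · rintro ⟨⟨h1, h2⟩ | ⟨h1, h2⟩, ⟨h3, h4⟩ | ⟨h3, h4⟩⟩
    · linarith
    · linarith
    · ext m
      fin_cases m
      · simpa using h1
      · simpa using h3
    · linarith
  · rintro rfl
    simp [hx.le, hy.le]

/-! ## Crowds and gadgets -/

/-- The position, relative to its midpoint, of the `s`-th center (`s = 0, …, t - 1`) of a `t`-crowd: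
`t` points equally distributed between `-ε` and `ε`; the single point is `0` if `t = 1`
(then the fraction is `0 / 0 = 0`). -/
noncomputable def crowdOffset (ε : ℝ) (t s : ℕ) : ℝ :=
  ε * ((2 * (s : ℝ) - ((t : ℝ) - 1)) / ((t : ℝ) - 1))

/-- The three kinds of gadgets; `Q1` is horizontal, `Q2` and `Q3` are vertical. -/
inductive Kind
  | Q1
  | Q2
  | Q3

/-- The number of crowds of a gadget (a single unit disk counts as a `1`-crowd). -/
def Kind.numCrowds : Kind → ℕ
  | .Q1 => 3
  | .Q2 => 4
  | .Q3 => 4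

/-- The sizes of the crowds of a gadget. -/
def Kind.size (n : ℕ) : (κ : Kind) → Fin κ.numCrowds → ℕ
  | .Q1 => ![n ^ 3, 2 * n ^ 6 - 2 * n ^ 3 + 2, n ^ 3]
  | .Q2 => ![1, n ^ 6, 1, n ^ 6]
  | .Q3 => ![1, n ^ 6, 1, n ^ 6]

/-- The distances of the midpoints of the crowds of a gadget from its origin, to the right for `Q1`
and upwards for `Q2` and `Q3`. -/
noncomputable def Kind.dist : (κ : Kind) → Fin κ.numCrowds → ℝ
  | .Q1 => ![0.9, 2.8, 4.7]
  | .Q2 => ![0, 1.8, 3.6, 5.4]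
  | .Q3 => ![0, 1.7, 3.6, 5.4]

/-- The point at position `a` along the axis of a gadget with origin `p`, displaced by `b` sideways
(upwards for the horizontal gadget `Q1`, to the right for the vertical gadgets `Q2` and `Q3`). -/
noncomputable def Kind.place (p : Plane) (a b : ℝ) : Kind → Plane
  | .Q1 => !₂[p 0 + a, p 1 + b]
  | .Q2 => !₂[p 0 + b, p 1 + a]
  | .Q3 => !₂[p 0 + b, p 1 + a]

/-- The gadgets of the construction. -/
inductive Gadget (n : ℕ)
  /-- `Q1` with origin `(0, (2(i-1)+j) d₂)`. -/
  | start (i : Fin n) (j : Fin 2)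
  /-- `Q1` with origin `q_{i,0}`. -/
  | auxQ (i : Fin n)
  /-- `Q2` with origin `r_{i,0}`. -/
  | auxR (i : Fin n)
  /-- `Q3` with origin `p_{i,j}`. -/
  | bend (i : Fin n) (j : Fin 2)
  /-- `Q1` with origin `(-d₁, (2i-1) d₂)`. -/
  | left₁ (i : Fin n)
  /-- `Q1` with origin `(-2d₁, (2i-1) d₂)`. -/
  | left₂ (i : Fin n)
  /-- `Q1` with origin at the crossing point of two tracks. -/
  | crossH (c : Crossing n)
  /-- `Q2` with origin at the crossing point of two tracks. -/
  | crossV (c : Crossing n)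
  deriving DecidableEq, Fintype

def Gadget.kind {n : ℕ} : Gadget n → Kind
  | .start _ _ => .Q1
  | .auxQ _ => .Q1
  | .auxR _ => .Q2
  | .bend _ _ => .Q3
  | .left₁ _ => .Q1
  | .left₂ _ => .Q1
  | .crossH _ => .Q1
  | .crossV _ => .Q2

noncomputable def Gadget.origin {n : ℕ} : Gadget n → Plane
  | .start i j => !₂[0, (2 * (idx i - 1) + (j : ℕ)) * d₂]
  | .auxQ i => XorBisection.auxQ i
  | .auxR i => XorBisection.auxR i
  | .bend i j => bendPoint i j
  | .left₁ i => !₂[-d₁, (2 * idx i - 1) * d₂]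
  | .left₂ i => !₂[-2 * d₁, (2 * idx i - 1) * d₂]
  | .crossH c => crossPoint c
  | .crossV c => crossPoint c

/-- The vertices: the disks of the crowds of the gadgets. -/
abbrev Vertex (n : ℕ) : Type :=
  Σ g : Gadget n, Σ b : Fin g.kind.numCrowds, Fin (g.kind.size n b)

/-! ## The modification for a formula -/

/-- The gadgets at the crossing of `T_{i,j}` and `T_{k,l}`, `i < k`, are modified if `x_i ⊕ x_k` is
a clause and `{j, l} = {0, 1}`. -/
def MonotoneXor.Modifies {n : ℕ} (φ : MonotoneXor n) (c : Crossing n) : Prop :=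
  (c.1.1.1, c.1.2.1) ∈ φ.clauses ∧ c.1.1.2 ≠ c.1.2.2

open Classical in
/-- `some δ` if one disk of the `b`-th crowd of the gadget is moved sideways by `δ`. At a modified
crossing this happens to the first crowd of the horizontal gadget (one disk is moved upwards) and to
the crowd at distance `1.8` of the vertical gadget (one disk is moved to the right). -/
noncomputable def MonotoneXor.moved {n : ℕ} (φ : MonotoneXor n) : Gadget n → ℕ → Option ℝ
  | .crossH c, 0 => if φ.Modifies c then some 0.01 else none
  | .crossV c, 1 => if φ.Modifies c then some 0.02 else none
  | _, _ => none

/-- The position (along the axis, sideways) of the `s`-th disk of a crowd of `t` disks with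
midpoint `0`. If a disk is moved sideways by `δ`, the crowd is replaced by a single disk displaced by
`δ` from the midpoint and a `(t-1)`-crowd. -/
noncomputable def diskOffset (ε : ℝ) (t : ℕ) : Option ℝ → ℕ → ℝ × ℝ
  | none, s => (crowdOffset ε t s, 0)
  | some δ, 0 => (0, δ)
  | some _, s + 1 => (crowdOffset ε (t - 1) s, 0)

/-- The centers of the unit disks of the representation `R_φ`. -/
noncomputable def MonotoneXor.center {n : ℕ} (φ : MonotoneXor n) (ε : ℝ) : Vertex n → Plane :=
  fun ⟨g, b, s⟩ =>
    let o := diskOffset ε (g.kind.size n b) (φ.moved g b) s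
    g.kind.place g.origin (g.kind.dist b + o.1) o.2

/-- The unit disk graph `H_φ`, built with crowds of half-width `ε`. -/
noncomputable def MonotoneXor.graphH {n : ℕ} (φ : MonotoneXor n) (ε : ℝ) :
    SimpleGraph (Vertex n) :=
  unitDiskGraph (φ.center ε)

end XorBisection

/-! Every track carries equally many disks: 2n + 2 gadgets of 2n⁶ + 2 disks each. Inside a track
consecutive pieces are tied together by about n⁶ common neighbours or by a complete bipartite graph
with n⁶ edges, so a cut of fewer than n⁶ - 2 edges cannot split a track (`mem_iff_of_same_track`).
The bound of the theorem is below n⁶ - 2, so a cheap bisection is a 2-colouring of the 2n tracks,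
and balance means that exactly n tracks have each colour (`isBisection_iff`).

Disks of different tracks touch only near crossings, and the two tracks of one variable do not
cross. At a crossing, the single disk of the vertical gadget touches the n³-crowds on its left and
right; a modified crossing has one further edge, between the two moved disks (`crossing_of_adj`,
`card_crossingEdges`). A colouring therefore cuts 2n³ edges per bichromatic pair of tracks of
different variables, plus one per modified bichromatic crossing (`cutSize_eq`).

Of the n² bichromatic pairs of tracks, those belonging to a single variable are free, and there are
at most n of them (`card_bichromaticPairs_add`). If there are fewer than n, the cut exceeds 2n⁴(n-1)
by at least 2n³ > 3n, which is too much. Hence T_{i,0} and T_{i,1} always have opposite colours, and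
the colours of the T_{i,0} form a truth assignment. Both modified crossings of a clause are then
bichromatic if the clause is violated, and neither is if it is satisfied (`card_modifiedPairs_add`).
The value is 2n⁴(n-1) + 2(m - s) = 2n⁴(n-1) + 3n - 2s, where s is the number of satisfied clauses.
-/

namespace XorBisection

/-! ## Grid coordinates of the gadgets -/

/-- The index `(i, j)` of the track `T_{i,j}`. -/
abbrev TrackIndex (n : ℕ) : Type := Fin n × Fin 2

variable {n : ℕ}

/-- The height of the horizontal part of a track, in units of `d₂`. -/
def bendRow (t : TrackIndex n) : ℤ := 2 * (t.1 : ℕ) + (t.2 : ℕ)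

/-- The abscissa of the vertical part of a track, in units of `d₁`. -/
def bendCol (t : TrackIndex n) : ℤ := 2 * (t.1 : ℕ) + 2 - (t.2 : ℕ)

/-- The abscissa of the leftmost gadget of a track, in units of `d₁`. -/
def startCol (t : TrackIndex n) : ℤ := -2 * (t.2 : ℕ)

/-- The abscissa of the origin of a gadget, in units of `d₁`. -/
def Gadget.col : Gadget n → ℤ
  | .start _ _ => 0
  | .auxQ i => 2 * (i : ℕ) + 1
  | .auxR i => 2 * (i : ℕ) + 2
  | .bend i j => bendCol (i, j)
  | .left₁ _ => -1
  | .left₂ _ => -2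
  | .crossH c => bendCol c.1.1
  | .crossV c => bendCol c.1.1

/-- The ordinate of the origin of a gadget, in units of `d₂`. -/
def Gadget.row : Gadget n → ℤ
  | .start i j => bendRow (i, j)
  | .auxQ i => 2 * (i : ℕ)
  | .auxR i => 2 * (i : ℕ) + 1
  | .bend i j => bendRow (i, j)
  | .left₁ i => 2 * (i : ℕ) + 1
  | .left₂ i => 2 * (i : ℕ) + 1
  | .crossH c => bendRow c.1.2
  | .crossV c => bendRow c.1.2

/-- The track that a gadget belongs to. -/
def Gadget.trackIndex : Gadget n → TrackIndex n
  | .start i j => (i, j)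
  | .auxQ i => (i, 0)
  | .auxR i => (i, 0)
  | .bend i j => (i, j)
  | .left₁ i => (i, 1)
  | .left₂ i => (i, 1)
  | .crossH c => c.1.2
  | .crossV c => c.1.1

theorem bendRow_injective : Function.Injective (bendRow (n := n)) := by
  rintro ⟨i, j⟩ ⟨k, l⟩ h
  simp only [bendRow] at h
  ext <;> simp only <;> omega

theorem bendCol_injective : Function.Injective (bendCol (n := n)) := by
  rintro ⟨i, j⟩ ⟨k, l⟩ h
  simp only [bendCol] at h
  ext <;> simp only <;> omega

theorem Gadget.row_eq {g : Gadget n} (hg : g.kind = .Q1) : g.row = bendRow g.trackIndex := by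
  cases g <;> simp_all [Gadget.row, Gadget.trackIndex, Gadget.kind, bendRow]

theorem Gadget.col_eq {g : Gadget n} (hg : g.kind ≠ .Q1) : g.col = bendCol g.trackIndex := by
  cases g <;> simp_all [Gadget.col, Gadget.trackIndex, Gadget.kind, bendCol]

theorem Gadget.startCol_le_col {g : Gadget n} (hg : g.kind = .Q1) :
    startCol g.trackIndex ≤ g.col := by
  cases g <;> simp_all [Gadget.col, Gadget.trackIndex, Gadget.kind, bendCol, startCol] <;> omega

theorem Gadget.col_lt {g : Gadget n} (hg : g.kind = .Q1) :
    g.col < bendCol g.trackIndex := by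
  cases g with
  | crossH c =>
    have := c.2
    simp only [Gadget.col, Gadget.trackIndex, bendCol]
    omega
  | _ => simp_all [Gadget.col, Gadget.trackIndex, Gadget.kind, bendCol] <;> omega

theorem Gadget.le_row {g : Gadget n} (hg : g.kind ≠ .Q1) : bendRow g.trackIndex ≤ g.row := by
  cases g with
  | crossV c =>
    have := c.2
    simp only [Gadget.row, Gadget.trackIndex, bendRow]
    omega
  | _ => simp_all [Gadget.row, Gadget.trackIndex, Gadget.kind, bendRow]

theorem Gadget.row_lt {g : Gadget n} (hg : g.kind ≠ .Q1) : g.row < 2 * n := by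
  cases g <;> simp_all [Gadget.row, Gadget.kind, bendRow] <;> omega

theorem Gadget.eq_of_col_eq {g g' : Gadget n} (hg : g.kind = .Q1) (hg' : g'.kind = .Q1)
    (ht : g.trackIndex = g'.trackIndex) (hc : g.col = g'.col) : g = g' := by
  cases g with
  | crossH c =>
    have := c.2
    cases g' with
    | crossH c' =>
      congr 1
      exact Subtype.ext (Prod.ext (bendCol_injective hc) ht)
    | _ =>
      simp_all [Gadget.col, Gadget.trackIndex, Gadget.kind, bendCol]
      try omega
  | _ =>
    cases g' with
    | crossH c =>
      have := c.2
      simp_all [Gadget.col, Gadget.trackIndex, Gadget.kind, bendCol, eq_comm, Prod.ext_iff]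
      try omega
    | _ =>
      simp_all [Gadget.col, Gadget.trackIndex, Gadget.kind]
      try omega

theorem Gadget.eq_of_row_eq {g g' : Gadget n} (hg : g.kind ≠ .Q1) (hg' : g'.kind ≠ .Q1)
    (ht : g.trackIndex = g'.trackIndex) (hc : g.row = g'.row) : g = g' := by
  cases g with
  | crossV c =>
    have := c.2
    cases g' with
    | crossV c' =>
      congr 1
      exact Subtype.ext (Prod.ext ht (bendRow_injective hc))
    | _ =>
      simp_all [Gadget.row, Gadget.trackIndex, Gadget.kind, bendRow]
      try omega
  | _ =>
    cases g' with
    | crossV c =>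
      have := c.2
      simp_all [Gadget.row, Gadget.trackIndex, Gadget.kind, bendRow, eq_comm, Prod.ext_iff]
      try omega
    | _ =>
      simp_all [Gadget.row, Gadget.trackIndex, Gadget.kind, bendRow]
      try omega

/-- The horizontal part has no gaps. With indices from 0, columns 1, …, 2k carry the crossings with
tracks of smaller variables; `start`, `auxQ`, `left₁` and `left₂` supply the remaining columns. -/
theorem Gadget.exists_of_col {t : TrackIndex n} {x : ℤ} (h₁ : startCol t ≤ x)
    (h₂ : x < bendCol t) : ∃ g : Gadget n, g.kind = .Q1 ∧ g.trackIndex = t ∧ g.col = x := by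
  obtain ⟨k, l⟩ := t
  simp only [startCol, bendCol] at h₁ h₂
  have hk := k.2
  by_cases hx : 1 ≤ x ∧ x ≤ 2 * (k : ℕ)
  -- Solves 2i + 2 - j = x with j ∈ {0, 1}: exactly one track bends in column x.
  · refine ⟨.crossH ⟨((⟨((x - 1) / 2).toNat, by omega⟩, ⟨(x % 2).toNat, by omega⟩), (k, l)), ?_⟩,
      rfl, rfl, ?_⟩
    · simp only [Fin.lt_def]
      omega
    · simp only [Gadget.col, bendCol]
      omega
  by_cases h0 : x = 0
  · exact ⟨.start k l, rfl, rfl, h0.symm⟩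
  by_cases hneg : x < 0
  · have hl : l = 1 := by ext; simp only [Fin.val_one]; omega
    subst hl
    by_cases h1 : x = -1
    · exact ⟨.left₁ k, rfl, rfl, h1.symm⟩
    · refine ⟨.left₂ k, rfl, rfl, ?_⟩
      simp only [Gadget.col, Fin.val_one] at *
      omega
  · have hl : l = 0 := by ext; simp only [Fin.val_zero]; omega
    subst hl
    refine ⟨.auxQ k, rfl, rfl, ?_⟩
    simp only [Gadget.col, Fin.val_zero] at *
    omega

/-- Rows from 2k + 2 on carry the crossings with tracks of larger variables. Row 2k + 1 belongs to
T_{k,1}, which T_{k,0} does not cross; there `auxR` closes the gap. -/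
theorem Gadget.exists_of_row {t : TrackIndex n} {y : ℤ} (h₁ : bendRow t ≤ y)
    (h₂ : y < 2 * n) : ∃ g : Gadget n, g.kind ≠ .Q1 ∧ g.trackIndex = t ∧ g.row = y := by
  obtain ⟨k, l⟩ := t
  by_cases h0 : y = bendRow (k, l)
  · exact ⟨.bend k l, by simp [Gadget.kind], rfl, h0.symm⟩
  simp only [bendRow] at h₁ h0
  by_cases hy : 2 * (k : ℕ) + 2 ≤ y
  · refine ⟨.crossV ⟨((k, l), (⟨(y / 2).toNat, by omega⟩, ⟨(y % 2).toNat, by omega⟩)), ?_⟩,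
      by simp [Gadget.kind], rfl, ?_⟩
    · simp only [Fin.lt_def]
      omega
    · simp only [Gadget.row, bendRow]
      omega
  · have hl : l = 0 := by ext; simp only [Fin.val_zero]; omega
    subst hl
    refine ⟨.auxR k, by simp [Gadget.kind], rfl, ?_⟩
    simp only [Gadget.row, Fin.val_zero] at *
    omega

-- The horizontal part has 2k + 2 + l gadgets and the vertical part 2n - 2k - l. The two extra
-- gadgets on the left of T_{k,1} make the sum independent of the track.
open Classical in
theorem Gadget.card_trackIndex_eq (t : TrackIndex n) :
    (Finset.univ.filter fun g : Gadget n => g.trackIndex = t).card = 2 * n + 2 := by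
  have hH : (Finset.univ.filter fun g : Gadget n => g.trackIndex = t ∧ g.kind = Kind.Q1).card =
      (Finset.Ico (startCol t) (bendCol t)).card := by
    refine Finset.card_nbij Gadget.col ?_ ?_ ?_
    · intro g hg
      simp only [Finset.coe_filter, Finset.mem_univ, true_and, Set.mem_ofPred_eq] at hg
      obtain ⟨rfl, hk⟩ := hg
      simpa using ⟨startCol_le_col hk, col_lt hk⟩
    · intro g hg g' hg' h
      simp only [Finset.coe_filter, Finset.mem_univ, true_and, Set.mem_ofPred_eq] at hg hg'
      exact eq_of_col_eq hg.2 hg'.2 (hg.1.trans hg'.1.symm) h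
    · intro x hx
      simp only [Finset.coe_Ico, Set.mem_Ico] at hx
      obtain ⟨g, h1, h2, h3⟩ := exists_of_col hx.1 hx.2
      exact ⟨g, by simp [h1, h2], h3⟩
  have hV : (Finset.univ.filter fun g : Gadget n => g.trackIndex = t ∧ ¬ g.kind = Kind.Q1).card =
      (Finset.Ico (bendRow t) (2 * n)).card := by
    refine Finset.card_nbij Gadget.row ?_ ?_ ?_
    · intro g hg
      simp only [Finset.coe_filter, Finset.mem_univ, true_and, Set.mem_ofPred_eq] at hg
      obtain ⟨rfl, hk⟩ := hg
      simpa using ⟨le_row hk, row_lt hk⟩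
    · intro g hg g' hg' h
      simp only [Finset.coe_filter, Finset.mem_univ, true_and, Set.mem_ofPred_eq] at hg hg'
      exact eq_of_row_eq hg.2 hg'.2 (hg.1.trans hg'.1.symm) h
    · intro x hx
      simp only [Finset.coe_Ico, Set.mem_Ico] at hx
      obtain ⟨g, h1, h2, h3⟩ := exists_of_row hx.1 hx.2
      exact ⟨g, by simp [h1, h2], h3⟩
  have := Finset.card_filter_add_card_filter_not
    (s := Finset.univ.filter fun g : Gadget n => g.trackIndex = t) (fun g => g.kind = Kind.Q1)
  rw [Finset.filter_filter, Finset.filter_filter, hH, hV, Int.card_Ico, Int.card_Ico] at this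
  rw [← this]
  simp only [bendRow, bendCol, startCol]
  omega

/-! ## Coordinates of the centers -/

theorem unitDiskGraph_adj_iff {V : Type*} {c : V → Plane} {u v : V} :
    (unitDiskGraph c).Adj u v ↔
      u ≠ v ∧ (c u 0 - c v 0) ^ 2 + (c u 1 - c v 1) ^ 2 ≤ 4 := by
  have hd : (c u 0 - c v 0) ^ 2 + (c u 1 - c v 1) ^ 2 = dist (c u) (c v) ^ 2 := by
    rw [EuclideanSpace.dist_eq, Real.sq_sqrt (by positivity), Fin.sum_univ_two, Real.dist_eq,
      Real.dist_eq, sq_abs, sq_abs]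
  rw [hd]
  refine and_congr_right fun _ => ⟨?_, fun h => ?_⟩
  · rintro ⟨x, hu, hv⟩
    rw [Metric.mem_closedBall] at hu hv
    have h₁ : dist (c u) (c v) ≤ 2 := by
      linarith [dist_triangle_left (c u) (c v) x]
    nlinarith [dist_nonneg (x := c u) (y := c v)]
  · have h₁ : dist (c u) (c v) ≤ 2 := by
      nlinarith [dist_nonneg (x := c u) (y := c v)]
    refine ⟨midpoint ℝ (c u) (c v), ?_, ?_⟩ <;>
      simp only [Metric.mem_closedBall, dist_midpoint_left, dist_midpoint_right, Real.norm_ofNat] <;>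
      linarith

theorem abs_crowdOffset_le {ε : ℝ} (hε : 0 < ε) {t s : ℕ} (hs : s < t) :
    |crowdOffset ε t s| ≤ ε := by
  have h₁ : (s : ℝ) + 1 ≤ t := by exact_mod_cast hs
  have h₂ : (0 : ℝ) ≤ s := s.cast_nonneg
  rw [crowdOffset, abs_mul, abs_of_pos hε]
  refine mul_le_of_le_one_right hε.le ?_
  rw [abs_div]
  -- This also covers t = 1, where the denominator is 0.
  refine div_le_one_of_le₀ ?_ (abs_nonneg _)
  rw [abs_of_nonneg (by linarith : (0 : ℝ) ≤ t - 1), abs_le]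
  constructor <;> linarith

/-- The position of a disk relative to the midpoint of its crowd: along the axis, and sideways. -/
noncomputable def MonotoneXor.offset (φ : MonotoneXor n) (ε : ℝ) (v : Vertex n) : ℝ × ℝ :=
  diskOffset ε (v.1.kind.size n v.2.1) (φ.moved v.1 v.2.1) v.2.2

theorem MonotoneXor.offset_cases (φ : MonotoneXor n) {ε : ℝ} (hε : 0 < ε) (v : Vertex n) :
    (|(φ.offset ε v).1| ≤ ε ∧ (φ.offset ε v).2 = 0) ∨
      ∃ δ, (φ.offset ε v).1 = 0 ∧ (φ.offset ε v).2 = δ ∧ (v.2.2 : ℕ) = 0 ∧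
        φ.moved v.1 v.2.1 = some δ := by
  obtain ⟨g, b, s, hs⟩ := v
  simp only [offset]
  rcases φ.moved g b with _ | δ
  · exact Or.inl ⟨abs_crowdOffset_le hε hs, rfl⟩
  · cases s with
    | zero => exact Or.inr ⟨δ, rfl, rfl, rfl, rfl⟩
    | succ s => exact Or.inl ⟨abs_crowdOffset_le hε (by omega), rfl⟩

theorem MonotoneXor.offset_of_moved (φ : MonotoneXor n) (ε : ℝ) {v : Vertex n} {δ : ℝ}
    (hs : (v.2.2 : ℕ) = 0) (hm : φ.moved v.1 v.2.1 = some δ) : φ.offset ε v = (0, δ) := by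
  rw [offset, hm, hs]
  rfl

theorem MonotoneXor.moved_eq_some {φ : MonotoneXor n} {g : Gadget n} {b : ℕ} {δ : ℝ}
    (h : φ.moved g b = some δ) :
    (∃ c, g = .crossH c ∧ b = 0 ∧ δ = 0.01 ∧ φ.Modifies c) ∨
      ∃ c, g = .crossV c ∧ b = 1 ∧ δ = 0.02 ∧ φ.Modifies c := by
  unfold moved at h
  split at h
  · split_ifs at h with hc
    exact Or.inl ⟨_, rfl, rfl, (Option.some_injective _ h).symm, hc⟩
  · split_ifs at h with hc
    exact Or.inr ⟨_, rfl, rfl, (Option.some_injective _ h).symm, hc⟩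
  · simp at h

theorem MonotoneXor.abs_offset_fst_le (φ : MonotoneXor n) {ε : ℝ} (hε : 0 < ε) (v : Vertex n) :
    |(φ.offset ε v).1| ≤ ε := by
  rcases φ.offset_cases hε v with h | ⟨δ, h, -⟩
  · exact h.1
  · simpa [h] using hε.le

theorem MonotoneXor.offset_snd_mem (φ : MonotoneXor n) {ε : ℝ} (hε : 0 < ε) (v : Vertex n) :
    0 ≤ (φ.offset ε v).2 ∧ (φ.offset ε v).2 ≤ 0.02 := by
  rcases φ.offset_cases hε v with h | ⟨δ, -, h, -, h'⟩
  · rw [h.2]; norm_num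
  · rw [h]
    rcases moved_eq_some h' with ⟨_, _, _, rfl, _⟩ | ⟨_, _, _, rfl, _⟩ <;> norm_num

theorem Kind.dist_of_eq_Q1 {κ : Kind} (h : κ = .Q1) (b : Fin κ.numCrowds) :
    ((b : ℕ) = 0 ∧ κ.dist b = 0.9) ∨ ((b : ℕ) = 1 ∧ κ.dist b = 2.8) ∨
      ((b : ℕ) = 2 ∧ κ.dist b = 4.7) := by
  subst h
  change Fin 3 at b
  fin_cases b <;> simp [Kind.dist]

theorem Kind.dist_of_ne_Q1 {κ : Kind} (h : κ ≠ .Q1) (b : Fin κ.numCrowds) :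
    ((b : ℕ) = 0 ∧ κ.dist b = 0) ∨
      ((b : ℕ) = 1 ∧ (κ = .Q2 ∧ κ.dist b = 1.8 ∨ κ = .Q3 ∧ κ.dist b = 1.7)) ∨
      ((b : ℕ) = 2 ∧ κ.dist b = 3.6) ∨ ((b : ℕ) = 3 ∧ κ.dist b = 5.4) := by
  cases κ
  · exact absurd rfl h
  all_goals
    change Fin 4 at b
    fin_cases b <;> simp [Kind.dist]

theorem Kind.size_of_eq_Q1 {κ : Kind} (h : κ = .Q1) (b : Fin κ.numCrowds) :
    ((b : ℕ) = 0 ∧ κ.size n b = n ^ 3) ∨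
      ((b : ℕ) = 1 ∧ κ.size n b = 2 * n ^ 6 - 2 * n ^ 3 + 2) ∨
      ((b : ℕ) = 2 ∧ κ.size n b = n ^ 3) := by
  subst h
  change Fin 3 at b
  fin_cases b <;> simp [Kind.size]

theorem Kind.size_of_ne_Q1 {κ : Kind} (h : κ ≠ .Q1) (b : Fin κ.numCrowds) :
    ((b : ℕ) = 0 ∧ κ.size n b = 1) ∨ ((b : ℕ) = 1 ∧ κ.size n b = n ^ 6) ∨
      ((b : ℕ) = 2 ∧ κ.size n b = 1) ∨ ((b : ℕ) = 3 ∧ κ.size n b = n ^ 6) := by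
  cases κ
  · exact absurd rfl h
  all_goals
    change Fin 4 at b
    fin_cases b <;> simp [Kind.size]

theorem Gadget.origin_zero (g : Gadget n) : g.origin 0 = g.col * d₁ := by
  cases g with
  | bend i j =>
    fin_cases j <;> simp [Gadget.origin, Gadget.col, bendPoint, bendCol, idx,
        -mul_eq_mul_right_iff] <;> ring
  | crossH c | crossV c =>
    obtain ⟨⟨⟨i, j⟩, ⟨k, l⟩⟩, hc⟩ := c
    fin_cases j <;>
      simp [Gadget.origin, Gadget.col, crossPoint, bendPoint, bendCol, idx,
        -mul_eq_mul_right_iff] <;> ring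
  | _ => simp [Gadget.origin, Gadget.col, idx, -mul_eq_mul_right_iff, XorBisection.auxQ,
      XorBisection.auxR] <;> ring

theorem Gadget.origin_one (g : Gadget n) : g.origin 1 = g.row * d₂ := by
  cases g with
  | bend i j =>
    fin_cases j <;> simp [Gadget.origin, Gadget.row, bendPoint, bendRow, idx,
        -mul_eq_mul_right_iff] <;> ring
  | crossH c | crossV c =>
    obtain ⟨⟨⟨i, j⟩, ⟨k, l⟩⟩, hc⟩ := c
    fin_cases l <;>
      simp [Gadget.origin, Gadget.row, crossPoint, bendPoint, bendRow, idx,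
        -mul_eq_mul_right_iff] <;> ring
  | _ =>
    simp [Gadget.origin, Gadget.row, bendRow, idx, -mul_eq_mul_right_iff, XorBisection.auxQ,
      XorBisection.auxR] <;>
      ring

/-- The position of a disk along the axis of its gadget. -/
noncomputable def MonotoneXor.axial (φ : MonotoneXor n) (ε : ℝ) (v : Vertex n) : ℝ :=
  v.1.kind.dist v.2.1 + (φ.offset ε v).1

theorem MonotoneXor.center_of_eq_Q1 (φ : MonotoneXor n) (ε : ℝ) {v : Vertex n}
    (h : v.1.kind = .Q1) :
    φ.center ε v 0 = v.1.col * d₁ + φ.axial ε v ∧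
      φ.center ε v 1 = v.1.row * d₂ + (φ.offset ε v).2 := by
  have : φ.center ε v = v.1.kind.place v.1.origin (φ.axial ε v) (φ.offset ε v).2 := rfl
  rw [this, h, ← Gadget.origin_zero, ← Gadget.origin_one]
  simp [Kind.place]

theorem MonotoneXor.center_of_ne_Q1 (φ : MonotoneXor n) (ε : ℝ) {v : Vertex n}
    (h : v.1.kind ≠ .Q1) :
    φ.center ε v 0 = v.1.col * d₁ + (φ.offset ε v).2 ∧
      φ.center ε v 1 = v.1.row * d₂ + φ.axial ε v := by
  have : φ.center ε v = v.1.kind.place v.1.origin (φ.axial ε v) (φ.offset ε v).2 := rfl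
  rw [this, ← Gadget.origin_zero, ← Gadget.origin_one]
  revert h
  cases v.1.kind <;> simp [Kind.place]

theorem MonotoneXor.adj_of_abs_le (φ : MonotoneXor n) {ε : ℝ} {u v : Vertex n} (huv : u ≠ v)
    (a b : ℝ) (ha : |φ.center ε u 0 - φ.center ε v 0| ≤ a)
    (hb : |φ.center ε u 1 - φ.center ε v 1| ≤ b) (hab : a ^ 2 + b ^ 2 ≤ 4) :
    (φ.graphH ε).Adj u v := by
  refine unitDiskGraph_adj_iff.2 ⟨huv, ?_⟩
  have h₁ := sq_le_sq' (abs_le.1 ha).1 (abs_le.1 ha).2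
  have h₂ := sq_le_sq' (abs_le.1 hb).1 (abs_le.1 hb).2
  linarith

/-! ## Adjacent disks of the same track -/

section Adjacent

variable (φ : MonotoneXor n) {ε : ℝ} (hε : 0 < ε) (hε' : ε < 1 / 1000) {u v : Vertex n}
include hε hε'

theorem MonotoneXor.adj_of_same_gadget (huv : u ≠ v) (hg : u.1 = v.1)
    (h₁ : (u.2.1 : ℕ) ≤ v.2.1 + 1) (h₂ : (v.2.1 : ℕ) ≤ u.2.1 + 1) : (φ.graphH ε).Adj u v := by
  obtain ⟨hu₁, hu₂⟩ := abs_le.1 (φ.abs_offset_fst_le hε u)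
  obtain ⟨hv₁, hv₂⟩ := abs_le.1 (φ.abs_offset_fst_le hε v)
  have hu := φ.offset_snd_mem hε u
  have hv := φ.offset_snd_mem hε v
  have hside : |(φ.offset ε u).2 - (φ.offset ε v).2| ≤ 0.02 := by
    rw [abs_le]; constructor <;> linarith
  -- Neighbouring crowds are at most 1.9 apart (0.9 to 2.8, or 1.7 to 3.6); the spread adds at most
  -- 2ε.
  have haxial : |φ.axial ε u - φ.axial ε v| ≤ 1.91 := by
    simp only [axial]
    obtain ⟨g, b, s⟩ := u
    obtain ⟨g', b', s'⟩ := v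
    obtain rfl : g = g' := hg
    dsimp only at *
    rw [abs_le]
    by_cases hk : g.kind = .Q1
    · rcases Kind.dist_of_eq_Q1 hk b with ⟨h, e⟩ | ⟨h, e⟩ | ⟨h, e⟩ <;>
      rcases Kind.dist_of_eq_Q1 hk b' with ⟨h', e'⟩ | ⟨h', e'⟩ | ⟨h', e'⟩ <;>
      first
      | omega
      | rw [e, e']
        constructor <;> norm_num at * <;> linarith
    · rcases Kind.dist_of_ne_Q1 hk b with ⟨h, e⟩ | ⟨h, ⟨-, e⟩ | ⟨-, e⟩⟩ | ⟨h, e⟩ | ⟨h, e⟩ <;>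
      rcases Kind.dist_of_ne_Q1 hk b' with ⟨h', e'⟩ | ⟨h', ⟨-, e'⟩ | ⟨-, e'⟩⟩ | ⟨h', e'⟩ | ⟨h', e'⟩ <;>
      first
      | omega
      | rw [e, e']
        constructor <;> norm_num at * <;> linarith
  by_cases hk : u.1.kind = .Q1
  · refine φ.adj_of_abs_le huv 1.91 0.02 ?_ ?_ (by norm_num)
    · rw [(φ.center_of_eq_Q1 ε hk).1, (φ.center_of_eq_Q1 ε (hg ▸ hk : v.1.kind = _)).1, hg,
        add_sub_add_left_eq_sub]
      exact haxial
    · rw [(φ.center_of_eq_Q1 ε hk).2, (φ.center_of_eq_Q1 ε (hg ▸ hk : v.1.kind = _)).2, hg,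
        add_sub_add_left_eq_sub]
      exact hside
  · refine φ.adj_of_abs_le huv 0.02 1.91 ?_ ?_ (by norm_num)
    · rw [(φ.center_of_ne_Q1 ε hk).1, (φ.center_of_ne_Q1 ε (hg ▸ hk : v.1.kind ≠ _)).1, hg,
        add_sub_add_left_eq_sub]
      exact hside
    · rw [(φ.center_of_ne_Q1 ε hk).2, (φ.center_of_ne_Q1 ε (hg ▸ hk : v.1.kind ≠ _)).2, hg,
        add_sub_add_left_eq_sub]
      exact haxial

theorem MonotoneXor.adj_of_col_eq_add_one (hu : u.1.kind = .Q1) (hv : v.1.kind = .Q1)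
    (hrow : u.1.row = v.1.row) (hcol : v.1.col = u.1.col + 1) (hb : (u.2.1 : ℕ) = 2)
    (hb' : (v.2.1 : ℕ) = 0) : (φ.graphH ε).Adj u v := by
  have huv : u ≠ v := by rintro rfl; omega
  obtain ⟨hu₁, hu₂⟩ := abs_le.1 (φ.abs_offset_fst_le hε u)
  obtain ⟨hv₁, hv₂⟩ := abs_le.1 (φ.abs_offset_fst_le hε v)
  have hu₃ := φ.offset_snd_mem hε u
  have hv₃ := φ.offset_snd_mem hε v
  have e : u.1.kind.dist u.2.1 = 4.7 := by
    have := Kind.dist_of_eq_Q1 hu u.2.1; simpa [hb] using this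
  have e' : v.1.kind.dist v.2.1 = 0.9 := by
    have := Kind.dist_of_eq_Q1 hv v.2.1; simpa [hb'] using this
  refine φ.adj_of_abs_le huv 1.91 0.02 ?_ ?_ (by norm_num)
  · rw [(φ.center_of_eq_Q1 ε hu).1, (φ.center_of_eq_Q1 ε hv).1, hcol, axial, axial, e, e', abs_le,
      d₁]
    push_cast
    constructor <;> linarith
  · rw [(φ.center_of_eq_Q1 ε hu).2, (φ.center_of_eq_Q1 ε hv).2, hrow, abs_le]
    constructor <;> linarith

theorem MonotoneXor.adj_of_row_eq_add_one (hu : u.1.kind ≠ .Q1) (hv : v.1.kind ≠ .Q1)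
    (hcol : u.1.col = v.1.col) (hrow : v.1.row = u.1.row + 1) (hb : (u.2.1 : ℕ) = 3)
    (hb' : (v.2.1 : ℕ) = 0) : (φ.graphH ε).Adj u v := by
  have huv : u ≠ v := by rintro rfl; omega
  obtain ⟨hu₁, hu₂⟩ := abs_le.1 (φ.abs_offset_fst_le hε u)
  obtain ⟨hv₁, hv₂⟩ := abs_le.1 (φ.abs_offset_fst_le hε v)
  have hu₃ := φ.offset_snd_mem hε u
  have hv₃ := φ.offset_snd_mem hε v
  have e : u.1.kind.dist u.2.1 = 5.4 := by
    have := Kind.dist_of_ne_Q1 hu u.2.1; simpa [hb] using this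
  have e' : v.1.kind.dist v.2.1 = 0 := by
    have := Kind.dist_of_ne_Q1 hv v.2.1; simpa [hb'] using this
  refine φ.adj_of_abs_le huv 0.02 1.91 ?_ ?_ (by norm_num)
  · rw [(φ.center_of_ne_Q1 ε hu).1, (φ.center_of_ne_Q1 ε hv).1, hcol, abs_le]
    constructor <;> linarith
  · rw [(φ.center_of_ne_Q1 ε hu).2, (φ.center_of_ne_Q1 ε hv).2, hrow, axial, axial, e, e', abs_le,
      d₂]
    push_cast
    constructor <;> linarith

/-- The reason for 1.7 in `Q3`: 0.9² + 1.7² < 4 links the horizontal part to the first n⁶-crowd of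
the bend, whereas 0.9² + 1.8² > 4 keeps the tracks apart at crossings. -/
theorem MonotoneXor.adj_of_bend (hu : u.1.kind = .Q1) (hv : v.1.kind = .Q3)
    (hrow : u.1.row = v.1.row) (hcol : v.1.col = u.1.col + 1) (hb : (u.2.1 : ℕ) = 2)
    (hb' : (v.2.1 : ℕ) = 1) : (φ.graphH ε).Adj u v := by
  have huv : u ≠ v := by rintro rfl; omega
  have hv' : v.1.kind ≠ .Q1 := by simp [hv]
  obtain ⟨hu₁, hu₂⟩ := abs_le.1 (φ.abs_offset_fst_le hε u)
  obtain ⟨hv₁, hv₂⟩ := abs_le.1 (φ.abs_offset_fst_le hε v)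
  have hu₃ := φ.offset_snd_mem hε u
  have hv₃ := φ.offset_snd_mem hε v
  have e : u.1.kind.dist u.2.1 = 4.7 := by
    have := Kind.dist_of_eq_Q1 hu u.2.1; simpa [hb] using this
  have e' : v.1.kind.dist v.2.1 = 1.7 := by
    have := Kind.dist_of_ne_Q1 hv' v.2.1; simpa [hb', hv] using this
  refine φ.adj_of_abs_le huv 0.93 1.73 ?_ ?_ (by norm_num)
  · rw [(φ.center_of_eq_Q1 ε hu).1, (φ.center_of_ne_Q1 ε hv').1, hcol, axial, e, abs_le, d₁]
    push_cast
    constructor <;> linarith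
  · rw [(φ.center_of_eq_Q1 ε hu).2, (φ.center_of_ne_Q1 ε hv').2, hrow, axial, e', abs_le]
    constructor <;> linarith

end Adjacent

/-! ## Adjacent disks of different tracks -/

theorem not_sq_add_sq_le {x y a b : ℝ} (hx : a ≤ |x|) (hy : b ≤ |y|) (ha : 0 ≤ a) (hb : 0 ≤ b)
    (hab : 4 < a ^ 2 + b ^ 2) : ¬ x ^ 2 + y ^ 2 ≤ 4 := by
  have h₁ := pow_le_pow_left₀ ha hx 2
  have h₂ := pow_le_pow_left₀ hb hy 2
  rw [sq_abs] at h₁ h₂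
  linarith

theorem Gadget.row_eq_of_eq_Q3 {g : Gadget n} (h : g.kind = .Q3) :
    g.row = bendRow g.trackIndex := by
  cases g <;> simp_all [Gadget.kind, Gadget.row, Gadget.trackIndex]

/-- The two moved centers differ by exactly (0.88, 1.79), and 0.88² + 1.79² < 4. -/
theorem MonotoneXor.adj_of_modifies (φ : MonotoneXor n) (ε : ℝ) {u v : Vertex n}
    {c : Crossing n} (hc : φ.Modifies c) (hu : u.1 = .crossH c)
    (hv : v.1 = .crossV c) (hb : (u.2.1 : ℕ) = 0) (hb' : (v.2.1 : ℕ) = 1)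
    (hs : (u.2.2 : ℕ) = 0) (hs' : (v.2.2 : ℕ) = 0) : (φ.graphH ε).Adj u v := by
  have huv : u ≠ v := by rintro rfl; omega
  have hku : u.1.kind = .Q1 := by rw [hu]; rfl
  have hkv : v.1.kind = .Q2 := by rw [hv]; rfl
  have hkv' : v.1.kind ≠ .Q1 := by simp [hkv]
  have e : u.1.kind.dist u.2.1 = 0.9 := by
    have := Kind.dist_of_eq_Q1 hku u.2.1; simpa [hb] using this
  have e' : v.1.kind.dist v.2.1 = 1.8 := by
    have := Kind.dist_of_ne_Q1 hkv' v.2.1; simpa [hb', hkv] using this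
  have o : φ.offset ε u = (0, 0.01) :=
    φ.offset_of_moved ε hs (by rw [hb, hu]; simp [moved, hc])
  have o' : φ.offset ε v = (0, 0.02) :=
    φ.offset_of_moved ε hs' (by rw [hb', hv]; simp [moved, hc])
  refine φ.adj_of_abs_le huv 0.88 1.79 ?_ ?_ (by norm_num)
  · rw [(φ.center_of_eq_Q1 ε hku).1, (φ.center_of_ne_Q1 ε hkv').1, axial, e, o, o', hu, hv, abs_le]
    simp only [Gadget.col]
    constructor <;> linarith
  · rw [(φ.center_of_eq_Q1 ε hku).2, (φ.center_of_ne_Q1 ε hkv').2, axial, e', o, o', hu, hv, abs_le]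
    simp only [Gadget.row]
    constructor <;> linarith

section Crossing

variable (φ : MonotoneXor n) {ε : ℝ} (hε : 0 < ε) (hε' : ε < 1 / 1000) {u v : Vertex n}
include hε hε'

theorem MonotoneXor.row_eq_of_adj (hu : u.1.kind = .Q1) (hv : v.1.kind = .Q1)
    (h : (φ.graphH ε).Adj u v) : u.1.row = v.1.row := by
  have h := (unitDiskGraph_adj_iff.1 h).2
  rw [(φ.center_of_eq_Q1 ε hu).2, (φ.center_of_eq_Q1 ε hv).2, d₂] at h
  have hu₃ := φ.offset_snd_mem hε u
  have hv₃ := φ.offset_snd_mem hε v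
  have h' := abs_le.1 (abs_le_of_sq_le_sq (b := (2 : ℝ)) (by nlinarith) (by norm_num) :
    |u.1.row * 7.2 + (φ.offset ε u).2 - (v.1.row * 7.2 + (φ.offset ε v).2)| ≤ 2)
  by_contra hne
  rcases lt_or_gt_of_ne hne with hlt | hlt
  · have : (u.1.row : ℝ) + 1 ≤ v.1.row := by exact_mod_cast hlt
    linarith [h'.1]
  · have : (v.1.row : ℝ) + 1 ≤ u.1.row := by exact_mod_cast hlt
    linarith [h'.2]

theorem MonotoneXor.col_eq_of_adj (hu : u.1.kind ≠ .Q1) (hv : v.1.kind ≠ .Q1)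
    (h : (φ.graphH ε).Adj u v) : u.1.col = v.1.col := by
  have h := (unitDiskGraph_adj_iff.1 h).2
  rw [(φ.center_of_ne_Q1 ε hu).1, (φ.center_of_ne_Q1 ε hv).1, d₁] at h
  have hu₃ := φ.offset_snd_mem hε u
  have hv₃ := φ.offset_snd_mem hε v
  have h' := abs_le.1 (abs_le_of_sq_le_sq (b := (2 : ℝ)) (by nlinarith) (by norm_num) :
    |u.1.col * 5.6 + (φ.offset ε u).2 - (v.1.col * 5.6 + (φ.offset ε v).2)| ≤ 2)
  by_contra hne
  rcases lt_or_gt_of_ne hne with hlt | hlt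
  · have : (u.1.col : ℝ) + 1 ≤ v.1.col := by exact_mod_cast hlt
    linarith [h'.1]
  · have : (v.1.col : ℝ) + 1 ≤ u.1.col := by exact_mod_cast hlt
    linarith [h'.2]

theorem MonotoneXor.adj_of_crossing (hu : u.1.kind = .Q1) (hv : v.1.kind ≠ .Q1)
    (hrow : u.1.row = v.1.row) (hb' : (v.2.1 : ℕ) = 0)
    (h : u.1.col = v.1.col ∧ (u.2.1 : ℕ) = 0 ∨ u.1.col + 1 = v.1.col ∧ (u.2.1 : ℕ) = 2) :
    (φ.graphH ε).Adj u v := by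
  have huv : u ≠ v := by rintro rfl; exact hv hu
  obtain ⟨hu₁, hu₂⟩ := abs_le.1 (φ.abs_offset_fst_le hε u)
  obtain ⟨hv₁, hv₂⟩ := abs_le.1 (φ.abs_offset_fst_le hε v)
  have hu₃ := φ.offset_snd_mem hε u
  have hv₃ := φ.offset_snd_mem hε v
  have e' : v.1.kind.dist v.2.1 = 0 := by
    have := Kind.dist_of_ne_Q1 hv v.2.1; simpa [hb'] using this
  refine φ.adj_of_abs_le huv 0.95 0.03 ?_ ?_ (by norm_num)
  · rcases h with ⟨hcol, hb⟩ | ⟨hcol, hb⟩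
    · have e : u.1.kind.dist u.2.1 = 0.9 := by
        have := Kind.dist_of_eq_Q1 hu u.2.1; simpa [hb] using this
      rw [(φ.center_of_eq_Q1 ε hu).1, (φ.center_of_ne_Q1 ε hv).1, hcol, axial, e, abs_le]
      constructor <;> linarith
    · have e : u.1.kind.dist u.2.1 = 4.7 := by
        have := Kind.dist_of_eq_Q1 hu u.2.1; simpa [hb] using this
      rw [(φ.center_of_eq_Q1 ε hu).1, (φ.center_of_ne_Q1 ε hv).1, ← hcol, axial, e, abs_le, d₁]
      push_cast
      constructor <;> linarith
  · rw [(φ.center_of_eq_Q1 ε hu).2, (φ.center_of_ne_Q1 ε hv).2, hrow, axial, e', abs_le]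
    constructor <;> linarith

/-- The spacing of the grid leaves only crowds at horizontal distance about 0.9. At vertical
distance about 1.8 the disks touch only if both have been moved towards each other. -/
theorem MonotoneXor.crossing_of_adj (hu : u.1.kind = .Q1) (hv : v.1.kind ≠ .Q1)
    (ht : u.1.trackIndex ≠ v.1.trackIndex) (h : (φ.graphH ε).Adj u v) :
    u.1.row = v.1.row ∧
      ((v.2.1 : ℕ) = 0 ∧
          (u.1.col = v.1.col ∧ (u.2.1 : ℕ) = 0 ∨ u.1.col + 1 = v.1.col ∧ (u.2.1 : ℕ) = 2) ∨
        u.1.col = v.1.col ∧ ((u.2.1 : ℕ) = 0 ∧ (u.2.2 : ℕ) = 0) ∧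
          ((v.2.1 : ℕ) = 1 ∧ (v.2.2 : ℕ) = 0) ∧ φ.moved u.1 u.2.1 = some 0.01) := by
  have h := (unitDiskGraph_adj_iff.1 h).2
  rw [(φ.center_of_eq_Q1 ε hu).1, (φ.center_of_ne_Q1 ε hv).1, (φ.center_of_eq_Q1 ε hu).2,
    (φ.center_of_ne_Q1 ε hv).2, d₁, d₂] at h
  have hX := abs_le.1 (abs_le_of_sq_le_sq (b := (2 : ℝ)) (by nlinarith) (by norm_num) :
    |u.1.col * 5.6 + φ.axial ε u - (v.1.col * 5.6 + (φ.offset ε v).2)| ≤ 2)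
  have hY := abs_le.1 (abs_le_of_sq_le_sq (b := (2 : ℝ)) (by nlinarith) (by norm_num) :
    |u.1.row * 7.2 + (φ.offset ε u).2 - (v.1.row * 7.2 + φ.axial ε v)| ≤ 2)
  obtain ⟨hu₁, hu₂⟩ := abs_le.1 (φ.abs_offset_fst_le hε u)
  obtain ⟨hv₁, hv₂⟩ := abs_le.1 (φ.abs_offset_fst_le hε v)
  obtain ⟨hu₃, hu₄⟩ := φ.offset_snd_mem hε u
  obtain ⟨hv₃, hv₄⟩ := φ.offset_snd_mem hε v
  have hcol : u.1.col = v.1.col ∧ (u.2.1 : ℕ) = 0 ∧ u.1.kind.dist u.2.1 = 0.9 ∨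
      u.1.col + 1 = v.1.col ∧ (u.2.1 : ℕ) = 2 ∧ u.1.kind.dist u.2.1 = 4.7 := by
    have hc : u.1.col + 2 ≤ v.1.col ∨ u.1.col + 1 = v.1.col ∨ u.1.col = v.1.col ∨
      v.1.col + 1 ≤ u.1.col := by omega
    simp only [axial] at hX
    rcases hc with hc | hc | hc | hc
    · have : (u.1.col : ℝ) + 2 ≤ v.1.col := by exact_mod_cast hc
      rcases Kind.dist_of_eq_Q1 hu u.2.1 with ⟨-, e⟩ | ⟨-, e⟩ | ⟨-, e⟩ <;> linarith
    · have : (u.1.col : ℝ) + 1 = v.1.col := by exact_mod_cast hc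
      rcases Kind.dist_of_eq_Q1 hu u.2.1 with ⟨-, e⟩ | ⟨-, e⟩ | e
      · linarith
      · linarith
      · exact Or.inr ⟨hc, e⟩
    · have : (u.1.col : ℝ) = v.1.col := by exact_mod_cast hc
      rcases Kind.dist_of_eq_Q1 hu u.2.1 with e | ⟨-, e⟩ | ⟨-, e⟩
      · exact Or.inl ⟨hc, e⟩
      · linarith
      · linarith
    · have : (v.1.col : ℝ) + 1 ≤ u.1.col := by exact_mod_cast hc
      rcases Kind.dist_of_eq_Q1 hu u.2.1 with ⟨-, e⟩ | ⟨-, e⟩ | ⟨-, e⟩ <;> linarith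
  -- 0.879 = 0.9 - 0.02 - 0.001: the sideways shift and the bound on ε.
  have hX' : 0.879 ≤ |u.1.col * 5.6 + φ.axial ε u - (v.1.col * 5.6 + (φ.offset ε v).2)| := by
    rw [le_abs, axial]
    rcases hcol with ⟨hc, -, e⟩ | ⟨hc, -, e⟩
    · rw [hc, e]; left; linarith
    · rw [← hc, e]; right; push_cast; linarith
  have hrow : u.1.row = v.1.row ∧
      ((v.2.1 : ℕ) = 0 ∨ (v.2.1 : ℕ) = 1 ∧ v.1.kind.dist v.2.1 = 1.8) := by
    have hc : u.1.row + 1 ≤ v.1.row ∨ u.1.row = v.1.row ∨ v.1.row + 1 = u.1.row ∨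
      v.1.row + 2 ≤ u.1.row := by omega
    simp only [axial] at hY
    rcases hc with hc | hc | hc | hc
    · have : (u.1.row : ℝ) + 1 ≤ v.1.row := by exact_mod_cast hc
      rcases Kind.dist_of_ne_Q1 hv v.2.1 with ⟨-, e⟩ | ⟨-, ⟨-, e⟩ | ⟨-, e⟩⟩ | ⟨-, e⟩ | ⟨-, e⟩ <;>
        linarith
    · have : (u.1.row : ℝ) = v.1.row := by exact_mod_cast hc
      rcases Kind.dist_of_ne_Q1 hv v.2.1 with ⟨e, -⟩ | ⟨h1, ⟨-, e⟩ | ⟨e, -⟩⟩ | ⟨-, e⟩ | ⟨-, e⟩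
      · exact ⟨hc, Or.inl e⟩
      · exact ⟨hc, Or.inr ⟨h1, e⟩⟩
      -- A `Q3` gadget lies in the row of its own track, so both disks would be on the same track.
      · refine absurd (bendRow_injective ?_) ht
        rw [← Gadget.row_eq hu, hc, Gadget.row_eq_of_eq_Q3 e]
      · linarith
      · linarith
    · have h1 : (v.1.row : ℝ) + 1 = u.1.row := by exact_mod_cast hc
      rcases Kind.dist_of_ne_Q1 hv v.2.1 with ⟨-, e⟩ | ⟨-, ⟨-, e⟩ | ⟨-, e⟩⟩ | ⟨-, e⟩ | ⟨hb, e⟩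
      · linarith
      · linarith
      · linarith
      · linarith
      -- The last crowd of the gadget one row below ends 7.2 - 5.4 = 1.8 below this row.
      · have hY' : 1.799 ≤ |u.1.row * 7.2 + (φ.offset ε u).2 - (v.1.row * 7.2 + φ.axial ε v)| := by
          rw [le_abs, ← h1, axial, e]
          left; linarith
        exact absurd h (not_sq_add_sq_le hX' hY' (by norm_num) (by norm_num) (by norm_num))
    · have : (v.1.row : ℝ) + 2 ≤ u.1.row := by exact_mod_cast hc
      rcases Kind.dist_of_ne_Q1 hv v.2.1 with ⟨-, e⟩ | ⟨-, ⟨-, e⟩ | ⟨-, e⟩⟩ | ⟨-, e⟩ | ⟨-, e⟩ <;>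
        linarith
  refine ⟨hrow.1, ?_⟩
  rcases hrow with ⟨hrow, hb' | ⟨hb', e'⟩⟩
  · refine Or.inl ⟨hb', ?_⟩
    rcases hcol with ⟨h1, h2, -⟩ | ⟨h1, h2, -⟩
    · exact Or.inl ⟨h1, h2⟩
    · exact Or.inr ⟨h1, h2⟩
  -- Without the upward move the vertical gap stays near 1.8, and 0.879² + 1.799² > 4.
  rcases φ.offset_cases hε u with ⟨-, hs⟩ | ⟨δ, ho, hs, hs0, hm⟩
  · have hY' : 1.799 ≤ |u.1.row * 7.2 + (φ.offset ε u).2 - (v.1.row * 7.2 + φ.axial ε v)| := by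
      rw [le_abs, hrow, axial, e', hs]
      right; linarith
    exact absurd h (not_sq_add_sq_le hX' hY' (by norm_num) (by norm_num) (by norm_num))
  obtain ⟨c, hc, hb, rfl, -⟩ : ∃ c, u.1 = .crossH c ∧ (u.2.1 : ℕ) = 0 ∧ δ = 0.01 ∧ φ.Modifies c := by
    rcases moved_eq_some hm with h | ⟨c, hc, -⟩
    · exact h
    · rw [hc] at hu
      exact absurd hu (by simp [Gadget.kind])
  rcases hcol with ⟨hcol, -, e⟩ | ⟨-, hb2, -⟩
  swap
  · omega
  -- Without the move to the right the horizontal gap is 0.9, and 0.9² + 1.789² > 4.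
  rcases φ.offset_cases hε v with ⟨-, hs'⟩ | ⟨δ', -, -, hs0', -⟩
  · have hX'' : 0.9 ≤ |u.1.col * 5.6 + φ.axial ε u - (v.1.col * 5.6 + (φ.offset ε v).2)| := by
      rw [le_abs, hcol, axial, e, ho, hs']
      left; linarith
    have hY' : 1.789 ≤ |u.1.row * 7.2 + (φ.offset ε u).2 - (v.1.row * 7.2 + φ.axial ε v)| := by
      rw [le_abs, hrow, axial, e', hs]
      right; linarith
    exact absurd h (not_sq_add_sq_le hX'' hY' (by norm_num) (by norm_num) (by norm_num))
  · exact Or.inr ⟨hcol, ⟨hb, hs0⟩, ⟨hb', hs0'⟩, hm⟩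

end Crossing

/-! ## Crowds -/

theorem Vertex.ext {u v : Vertex n} (h₁ : u.1 = v.1) (h₂ : (u.2.1 : ℕ) = v.2.1)
    (h₃ : (u.2.2 : ℕ) = v.2.2) : u = v := by
  obtain ⟨g, b, s⟩ := u
  obtain ⟨g', b', s'⟩ := v
  obtain rfl : g = g' := h₁
  obtain rfl : b = b' := Fin.ext h₂
  obtain rfl : s = s' := Fin.ext h₃
  rfl

/-- The disks of the `b`-th crowd of a gadget. -/
def crowd (g : Gadget n) (b : ℕ) : Finset (Vertex n) :=
  Finset.univ.filter fun v => v.1 = g ∧ (v.2.1 : ℕ) = b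

theorem mem_crowd {g : Gadget n} {b : ℕ} {v : Vertex n} :
    v ∈ crowd g b ↔ v.1 = g ∧ (v.2.1 : ℕ) = b := by
  simp [crowd]

theorem card_crowd (g : Gadget n) (b : Fin g.kind.numCrowds) :
    (crowd g b).card = g.kind.size n b := by
  rw [← Fintype.card_fin (g.kind.size n b), ← Finset.card_univ]
  refine (Finset.card_nbij (fun s => ⟨g, b, s⟩) (fun s _ => ?_) (fun s _ s' _ h => ?_)
    (fun v hv => ?_)).symm
  · simp [mem_crowd]
  · simpa using h
  · obtain ⟨g', b', s⟩ := v
    obtain ⟨h₁, h₂⟩ := mem_crowd.1 hv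
    obtain rfl : g' = g := h₁
    obtain rfl : b' = b := Fin.ext h₂
    exact ⟨s, by simp, rfl⟩

theorem card_crowd_of_eq_Q1 {g : Gadget n} (h : g.kind = .Q1) :
    (crowd g 0).card = n ^ 3 ∧ (crowd g 1).card = 2 * n ^ 6 - 2 * n ^ 3 + 2 ∧
      (crowd g 2).card = n ^ 3 := by
  have hn : g.kind.numCrowds = 3 := by rw [h]; rfl
  refine ⟨?_, ?_, ?_⟩
  · exact (card_crowd g ⟨0, by omega⟩).trans (by simpa using Kind.size_of_eq_Q1 h ⟨0, by omega⟩)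
  · exact (card_crowd g ⟨1, by omega⟩).trans (by simpa using Kind.size_of_eq_Q1 h ⟨1, by omega⟩)
  · exact (card_crowd g ⟨2, by omega⟩).trans (by simpa using Kind.size_of_eq_Q1 h ⟨2, by omega⟩)

theorem card_crowd_of_ne_Q1 {g : Gadget n} (h : g.kind ≠ .Q1) :
    (crowd g 0).card = 1 ∧ (crowd g 1).card = n ^ 6 ∧
      (crowd g 2).card = 1 ∧ (crowd g 3).card = n ^ 6 := by
  have hn : g.kind.numCrowds = 4 := by
    revert h
    cases g.kind <;> simp [Kind.numCrowds]
  refine ⟨?_, ?_, ?_, ?_⟩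
  · exact (card_crowd g ⟨0, by omega⟩).trans (by simpa using Kind.size_of_ne_Q1 h ⟨0, by omega⟩)
  · exact (card_crowd g ⟨1, by omega⟩).trans (by simpa using Kind.size_of_ne_Q1 h ⟨1, by omega⟩)
  · exact (card_crowd g ⟨2, by omega⟩).trans (by simpa using Kind.size_of_ne_Q1 h ⟨2, by omega⟩)
  · exact (card_crowd g ⟨3, by omega⟩).trans (by simpa using Kind.size_of_ne_Q1 h ⟨3, by omega⟩)

/-! ## The cut of a colouring of the tracks -/

open Classical in
theorem cutSize_eq_card {V : Type*} [Fintype V] (G : SimpleGraph V) (A : Finset V) :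
    cutSize G A =
      (Finset.univ.filter fun p : V × V => p.1 ∈ A ∧ p.2 ∉ A ∧ G.Adj p.1 p.2).card := by
  unfold cutSize
  congr 1
  ext p
  simp [SimpleGraph.mem_interedges_iff]

open Classical in
/-- The adjacent pairs of a disk on the horizontal part of the track `b` and a disk on the vertical
part of the track `a`. -/
noncomputable def MonotoneXor.crossingEdges (φ : MonotoneXor n) (ε : ℝ) (a b : TrackIndex n) :
    Finset (Vertex n × Vertex n) :=
  Finset.univ.filter fun p => (p.1.1.kind = Kind.Q1 ∧ p.2.1.kind ≠ Kind.Q1) ∧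
    p.2.1.trackIndex = a ∧ p.1.1.trackIndex = b ∧ (φ.graphH ε).Adj p.1 p.2

theorem MonotoneXor.mem_crossingEdges {φ : MonotoneXor n} {ε : ℝ} {a b : TrackIndex n}
    {p : Vertex n × Vertex n} : p ∈ φ.crossingEdges ε a b ↔
      (p.1.1.kind = .Q1 ∧ p.2.1.kind ≠ .Q1) ∧
        p.2.1.trackIndex = a ∧ p.1.1.trackIndex = b ∧ (φ.graphH ε).Adj p.1 p.2 := by
  simp [crossingEdges]

/-- The row and column of a bend add up to 4i + 2 for either track of the variable. The hypotheses
compare both coordinates of the two bends, one of them strictly, so adding gives a strict inequality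
of variables. In particular, tracks of one variable do not meet. -/
theorem fst_lt_fst_of_col_le_of_row_eq {u v : Gadget n} (hu : u.kind = .Q1) (hv : v.kind ≠ .Q1)
    (ht : v.trackIndex ≠ u.trackIndex) (hrow : u.row = v.row) (hcol : v.col ≤ u.col + 1) :
    v.trackIndex.1 < u.trackIndex.1 := by
  have h₁ := Gadget.col_lt hu
  have h₂ := Gadget.le_row hv
  rw [Gadget.col_eq hv] at hcol
  rw [← hrow, Gadget.row_eq hu] at h₂
  have h₃ : bendRow v.trackIndex ≠ bendRow u.trackIndex := fun h => ht (bendRow_injective h)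
  simp only [bendRow, bendCol] at *
  rw [Fin.lt_def]
  omega

theorem MonotoneXor.crossingEdges_eq_empty (φ : MonotoneXor n) {ε : ℝ} (hε : 0 < ε)
    (hε' : ε < 1 / 1000) {a b : TrackIndex n} (hab : a ≠ b) (hlt : ¬ a.1 < b.1) :
    φ.crossingEdges ε a b = ∅ := by
  refine Finset.eq_empty_of_forall_notMem fun p hp => ?_
  obtain ⟨⟨hu, hv⟩, rfl, rfl, hadj⟩ := mem_crossingEdges.1 hp
  obtain ⟨hrow, h⟩ := φ.crossing_of_adj hε hε' hu hv hab.symm hadj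
  exact hlt (fst_lt_fst_of_col_le_of_row_eq hu hv hab hrow (by omega))

open Classical in
theorem MonotoneXor.card_crossingEdges (φ : MonotoneXor n) {ε : ℝ} (hε : 0 < ε)
    (hε' : ε < 1 / 1000) (c : Crossing n) :
    (φ.crossingEdges ε c.1.1 c.1.2).card = 2 * n ^ 3 + if φ.Modifies c then 1 else 0 := by
  have hn : 0 < n := c.1.1.1.pos
  have hlt := c.2
  -- The gadget one column to the left; its last crowd has midpoint 5.6 - 4.7 = 0.9 to the left of
  -- the crossing point.
  obtain ⟨g, hg, hgt, hgc⟩ : ∃ g : Gadget n, g.kind = .Q1 ∧ g.trackIndex = c.1.2 ∧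
      g.col = bendCol c.1.1 - 1 := by
    refine Gadget.exists_of_col ?_ ?_ <;> simp only [startCol, bendCol] <;> omega
  have hgr : g.row = bendRow c.1.2 := by rw [Gadget.row_eq hg, hgt]
  have hne : c.1.2 ≠ c.1.1 := fun h => by rw [h] at hlt; exact lt_irrefl _ hlt
  let u₀ : Vertex n := ⟨.crossH c, (0 : Fin 3), (⟨0, by positivity⟩ : Fin (n ^ 3))⟩
  let v₀ : Vertex n := ⟨.crossV c, (1 : Fin 4), (⟨0, by positivity⟩ : Fin (n ^ 6))⟩
  have key : φ.crossingEdges ε c.1.1 c.1.2 =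
      (crowd (.crossH c) 0 ×ˢ crowd (.crossV c) 0 ∪ crowd g 2 ×ˢ crowd (.crossV c) 0) ∪
        if φ.Modifies c then {(u₀, v₀)} else ∅ := by
    ext ⟨u, v⟩
    rw [mem_crossingEdges]
    simp only [Finset.mem_union, Finset.mem_product, mem_crowd]
    constructor
    · rintro ⟨⟨hu, hv⟩, hvt, hut, hadj⟩
      obtain ⟨hrow, h⟩ := φ.crossing_of_adj hε hε' hu hv (by rw [hut, hvt]; exact hne) hadj
      have hv' : v.1 = .crossV c := by
        refine Gadget.eq_of_row_eq hv (by simp [Gadget.kind]) hvt ?_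
        rw [← hrow, Gadget.row_eq hu, hut]
        rfl
      have hvc : v.1.col = bendCol c.1.1 := by rw [hv']; rfl
      have hu' : u.1.col = v.1.col → u.1 = .crossH c := fun h =>
        Gadget.eq_of_col_eq hu rfl hut (h.trans hvc)
      rcases h with ⟨hb', ⟨hcol, hb⟩ | ⟨hcol, hb⟩⟩ | ⟨hcol, ⟨hb, hs⟩, ⟨hb', hs'⟩, hm⟩
      · exact Or.inl (Or.inl ⟨⟨hu' hcol, hb⟩, hv', hb'⟩)
      · refine Or.inl (Or.inr ⟨⟨Gadget.eq_of_col_eq hu hg (hut.trans hgt.symm) ?_, hb⟩, hv', hb'⟩)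
        omega
      · right
        rw [hb, hu' hcol] at hm
        have hmod : φ.Modifies c := by
          by_contra hmod
          simp [moved, hmod] at hm
        rw [if_pos hmod, Finset.mem_singleton, Prod.mk.injEq]
        exact ⟨Vertex.ext (hu' hcol) hb hs, Vertex.ext hv' hb' hs'⟩
    · rintro ((⟨⟨hu, hb⟩, hv, hb'⟩ | ⟨⟨hu, hb⟩, hv, hb'⟩) | h)
      · have hk : u.1.kind = .Q1 := by rw [hu]; rfl
        have hk' : v.1.kind ≠ .Q1 := by rw [hv]; simp [Gadget.kind]
        refine ⟨⟨hk, hk'⟩, by rw [hv]; rfl, by rw [hu]; rfl,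
          φ.adj_of_crossing hε hε' hk hk' (by rw [hu, hv]; rfl) hb' (Or.inl ⟨?_, hb⟩)⟩
        rw [hu, hv]; rfl
      · have hk : u.1.kind = .Q1 := by rw [hu]; exact hg
        have hk' : v.1.kind ≠ .Q1 := by rw [hv]; simp [Gadget.kind]
        refine ⟨⟨hk, hk'⟩, by rw [hv]; rfl, by rw [hu]; exact hgt,
          φ.adj_of_crossing hε hε' hk hk' (by rw [hu, hv, hgr]; rfl) hb' (Or.inr ⟨?_, hb⟩)⟩
        rw [hu, hv, hgc]
        simp [Gadget.col]
      · split_ifs at h with hmod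
        · obtain ⟨rfl, rfl⟩ := Prod.mk.inj (Finset.mem_singleton.1 h)
          exact ⟨⟨rfl, by simp [v₀, Gadget.kind]⟩, rfl, rfl,
            φ.adj_of_modifies ε hmod rfl rfl rfl rfl rfl rfl⟩
        · simp at h
  have hgne : Gadget.crossH c ≠ g := by
    rintro rfl
    simp only [Gadget.col] at hgc
    omega
  rw [key, Finset.card_union_of_disjoint, Finset.card_union_of_disjoint, Finset.card_product,
    Finset.card_product, (card_crowd_of_eq_Q1 hg).2.2,
    (card_crowd_of_eq_Q1 (g := .crossH c) rfl).1,
    (card_crowd_of_ne_Q1 (g := .crossV c) (by simp [Gadget.kind])).1]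
  · split_ifs <;> simp <;> ring
  · rw [Finset.disjoint_left]
    rintro ⟨u, v⟩ h₁ h₂
    simp only [Finset.mem_product, mem_crowd] at h₁ h₂
    exact hgne (h₁.1.1.symm.trans h₂.1.1)
  · split_ifs
    · simp [mem_crowd, v₀]
    · simp

open Classical in
theorem MonotoneXor.cutSize_eq_sum (φ : MonotoneXor n) {ε : ℝ} (hε : 0 < ε)
    (hε' : ε < 1 / 1000) (f : TrackIndex n → Bool) (A : Finset (Vertex n))
    (hA : ∀ v, v ∈ A ↔ f v.1.trackIndex = true) :
    cutSize (φ.graphH ε) A = ∑ t : TrackIndex n × TrackIndex n,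
      if t.1.1 < t.2.1 ∧ f t.1 ≠ f t.2 then
        2 * n ^ 3 + if (t.1.1, t.2.1) ∈ φ.clauses ∧ t.1.2 ≠ t.2.2 then 1 else 0
      else 0 := by
  let D : Finset (Vertex n × Vertex n) := Finset.univ.filter fun p =>
    (p.1.1.kind = Kind.Q1 ∧ p.2.1.kind ≠ Kind.Q1) ∧ f p.2.1.trackIndex ≠ f p.1.1.trackIndex ∧
      (φ.graphH ε).Adj p.1 p.2
  have hD : cutSize (φ.graphH ε) A = D.card := by
    rw [cutSize_eq_card]
    -- Edges listed with the end in `A` first are relisted with the horizontal end first; the colour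
    -- recovers the old order. Two horizontal or two vertical ends share a track, so such edges are
    -- not cut.
    refine Finset.card_nbij' (fun p => if p.1.1.kind = Kind.Q1 then p else p.swap)
      (fun p => if f p.1.1.trackIndex = true then p else p.swap) ?_ ?_ ?_ ?_
    · rintro ⟨u, v⟩ h
      simp only [Finset.coe_filter, Finset.mem_univ, true_and, Set.mem_ofPred_eq, hA] at h
      obtain ⟨h₁, h₂, hadj⟩ := h
      have h₂ := Bool.eq_false_of_not_eq_true h₂
      by_cases hu : u.1.kind = Kind.Q1 <;> by_cases hv : v.1.kind = Kind.Q1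
      · have hr := φ.row_eq_of_adj hε hε' hu hv hadj
        rw [Gadget.row_eq hu, Gadget.row_eq hv] at hr
        rw [bendRow_injective hr, h₂] at h₁
        exact absurd h₁ (by simp)
      · simp [D, hu, hv, h₁, h₂, hadj]
      · simp [D, hu, hv, h₁, h₂, hadj.symm]
      · have hr := φ.col_eq_of_adj hε hε' hu hv hadj
        rw [Gadget.col_eq hu, Gadget.col_eq hv] at hr
        rw [bendCol_injective hr, h₂] at h₁
        exact absurd h₁ (by simp)
    · rintro ⟨u, v⟩ h
      simp only [D, Finset.coe_filter, Finset.mem_univ, true_and, Set.mem_ofPred_eq] at h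
      obtain ⟨-, h, hadj⟩ := h
      by_cases hf : f u.1.trackIndex = true
      · have h : f v.1.trackIndex = false := by simpa [hf] using h
        simp [hf, hA, hadj, h]
      · simp only [Bool.not_eq_true] at hf
        have h : f v.1.trackIndex = true := by simpa [hf] using h
        simp [hf, hA, hadj.symm, h]
    · rintro ⟨u, v⟩ h
      simp only [Finset.coe_filter, Finset.mem_univ, true_and, Set.mem_ofPred_eq, hA] at h
      obtain ⟨h₁, h₂, -⟩ := h
      have h₂ := Bool.eq_false_of_not_eq_true h₂
      by_cases hu : u.1.kind = Kind.Q1 <;> simp [hu, h₁, h₂]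
    · rintro ⟨u, v⟩ h
      simp only [D, Finset.coe_filter, Finset.mem_univ, true_and, Set.mem_ofPred_eq] at h
      obtain ⟨⟨hu, hv⟩, -, -⟩ := h
      by_cases hf : f u.1.trackIndex = true <;> simp [hf, hu, hv]
  rw [hD, Finset.card_eq_sum_card_fiberwise
    (f := fun p => (p.2.1.trackIndex, p.1.1.trackIndex)) (t := Finset.univ) (by simp)]
  refine Finset.sum_congr rfl fun ⟨a, b⟩ _ => ?_
  have hfib : (D.filter fun p => (p.2.1.trackIndex, p.1.1.trackIndex) = (a, b)) =
      if f a ≠ f b then φ.crossingEdges ε a b else ∅ := by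
    ext p
    by_cases hf : f a = f b
    · simp only [D, Finset.mem_filter, Finset.mem_univ, true_and, Prod.mk.injEq, hf, ne_eq,
        not_true_eq_false, if_false, Finset.notMem_empty, iff_false]
      rintro ⟨⟨-, h, -⟩, rfl, rfl⟩
      exact h hf
    · simp only [D, Finset.mem_filter, Finset.mem_univ, true_and, Prod.mk.injEq, ne_eq, hf,
        not_false_eq_true, if_true, mem_crossingEdges]
      constructor
      · rintro ⟨⟨h₁, -, h₂⟩, h₃, h₄⟩
        exact ⟨h₁, h₃, h₄, h₂⟩
      · rintro ⟨h₁, rfl, rfl, h₂⟩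
        exact ⟨⟨h₁, hf, h₂⟩, rfl, rfl⟩
  rw [hfib]
  by_cases hf : f a = f b
  · simp [hf]
  have hab : a ≠ b := fun h => hf (by rw [h])
  simp only [ne_eq, hf, not_false_eq_true, if_true, and_true]
  split_ifs with hlt hc
  · exact (φ.card_crossingEdges hε hε' ⟨(a, b), hlt⟩).trans
      (by rw [if_pos (show φ.Modifies ⟨(a, b), hlt⟩ from hc)])
  · exact (φ.card_crossingEdges hε hε' ⟨(a, b), hlt⟩).trans
      (by rw [if_neg (show ¬ φ.Modifies ⟨(a, b), hlt⟩ from hc)])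
  · rw [φ.crossingEdges_eq_empty hε hε' hab hlt, Finset.card_empty]

/-! ## Cheap cuts do not split a track -/

-- Every common neighbour is separated from `u` or from `v`. The 2 allows for `u` and `v` themselves
-- lying in `S`.
open Classical in
theorem card_le_cutSize_add_two {V : Type*} [Fintype V] {G : SimpleGraph V} {A S : Finset V}
    {u v : V} (hu : u ∈ A) (hv : v ∉ A)
    (h : ∀ w ∈ S, (w ≠ u → G.Adj u w) ∧ (w ≠ v → G.Adj w v)) :
    S.card ≤ cutSize G A + 2 := by
  have h₁ : (S \ {u, v}).card ≤ cutSize G A := by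
    rw [cutSize_eq_card]
    refine Finset.card_le_card_of_injOn (fun w => if w ∈ A then (w, v) else (u, w)) ?_ ?_
    · intro w hw
      simp only [Finset.coe_sdiff, Set.mem_sdiff, Finset.mem_coe, Finset.mem_insert,
        Finset.mem_singleton, not_or] at hw
      obtain ⟨h₁, h₂⟩ := h w hw.1
      by_cases hwA : w ∈ A
      · simp [hwA, hv, h₂ hw.2.2]
      · simp [hwA, hu, h₁ hw.2.1]
    · intro w hw w' hw' e
      simp only [Finset.coe_sdiff, Set.mem_sdiff, Finset.mem_coe, Finset.mem_insert,
        Finset.mem_singleton, not_or] at hw hw'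
      by_cases hwA : w ∈ A <;> by_cases hwA' : w' ∈ A <;> simp [hwA, hwA'] at e
      · exact e
      · exact absurd e.1 hw.2.1
      · exact absurd e.1.symm hw'.2.1
      · exact e
  have h₂ := Finset.le_card_sdiff ({u, v} : Finset V) S
  have h₃ : ({u, v} : Finset V).card ≤ 2 := Finset.card_le_two
  omega

open Classical in
theorem card_mul_card_le_cutSize {V : Type*} [Fintype V] {G : SimpleGraph V} {A X Y : Finset V}
    (hX : ∀ x ∈ X, x ∈ A) (hY : ∀ y ∈ Y, y ∉ A) (h : ∀ x ∈ X, ∀ y ∈ Y, G.Adj x y) :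
    X.card * Y.card ≤ cutSize G A := by
  rw [cutSize_eq_card, ← Finset.card_product]
  refine Finset.card_le_card fun p hp => ?_
  rw [Finset.mem_product] at hp
  simp [hX _ hp.1, hY _ hp.2, h _ hp.1 _ hp.2]

theorem Gadget.exists_vertex (hn : 2 ≤ n) (g : Gadget n) : ∃ v : Vertex n, v.1 = g := by
  have : 0 < (crowd g 0).card := by
    by_cases hk : g.kind = .Q1
    · rw [(card_crowd_of_eq_Q1 hk).1]; positivity
    · rw [(card_crowd_of_ne_Q1 hk).1]; norm_num
  obtain ⟨v, hv⟩ := Finset.card_pos.1 this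
  exact ⟨v, (mem_crowd.1 hv).1⟩

section Monochromatic

variable (φ : MonotoneXor n) {ε : ℝ} (hε : 0 < ε) (hε' : ε < 1 / 1000) (hn : 2 ≤ n)
  {A : Finset (Vertex n)} (hA : cutSize (φ.graphH ε) A + 2 < n ^ 6)
include hA

theorem MonotoneXor.mem_iff_of_common {u v : Vertex n} {S : Finset (Vertex n)}
    (hS : n ^ 6 ≤ S.card)
    (h : ∀ w ∈ S, (w ≠ u → (φ.graphH ε).Adj u w) ∧ (w ≠ v → (φ.graphH ε).Adj v w)) :
    u ∈ A ↔ v ∈ A := by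
  by_contra hne
  by_cases hu : u ∈ A
  · have hv : v ∉ A := fun hv => hne ⟨fun _ => hv, fun _ => hu⟩
    have := card_le_cutSize_add_two (G := φ.graphH ε) hu hv
      fun w hw => ⟨(h w hw).1, fun hwv => ((h w hw).2 hwv).symm⟩
    omega
  · have hv : v ∈ A := by
      by_contra hv
      exact hne ⟨fun h => absurd h hu, fun h => absurd h hv⟩
    have := card_le_cutSize_add_two (G := φ.graphH ε) hv hu
      fun w hw => ⟨(h w hw).2, fun hwv => ((h w hw).1 hwv).symm⟩
    omega

include hε hε'

theorem MonotoneXor.mem_iff_of_crowd {g : Gadget n} {b : ℕ} (hb : n ^ 6 ≤ (crowd g b).card)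
    {u v : Vertex n} (hu : u.1 = g) (hv : v.1 = g) (hu₁ : (u.2.1 : ℕ) ≤ b + 1)
    (hu₂ : b ≤ u.2.1 + 1) (hv₁ : (v.2.1 : ℕ) ≤ b + 1) (hv₂ : b ≤ v.2.1 + 1) :
    u ∈ A ↔ v ∈ A := by
  refine φ.mem_iff_of_common hA hb fun w hw => ?_
  obtain ⟨hwg, rfl⟩ := mem_crowd.1 hw
  exact ⟨fun h => φ.adj_of_same_gadget hε hε' h.symm (hu.trans hwg.symm) hu₁ hu₂,
    fun h => φ.adj_of_same_gadget hε hε' h.symm (hv.trans hwg.symm) hv₁ hv₂⟩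

include hn

/-- In `Q1` the middle crowd is adjacent to everything. In the vertical gadgets the single disk
between the two n⁶-crowds links them. -/
theorem MonotoneXor.mem_iff_of_same_gadget {u v : Vertex n} (huv : u.1 = v.1) :
    u ∈ A ↔ v ∈ A := by
  by_cases hk : v.1.kind = .Q1
  · have hb : n ^ 6 ≤ (crowd v.1 1).card := by
      rw [(card_crowd_of_eq_Q1 hk).2.1]
      have : n ^ 6 = n ^ 3 * n ^ 3 := by ring
      have : 2 ≤ n ^ 3 := hn.trans (Nat.le_self_pow (by norm_num) n)
      nlinarith [Nat.sub_add_cancel (show 2 * n ^ 3 ≤ 2 * n ^ 6 by nlinarith)]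
    have hu := Kind.dist_of_eq_Q1 (huv ▸ hk) u.2.1
    have hv := Kind.dist_of_eq_Q1 hk v.2.1
    exact φ.mem_iff_of_crowd hε hε' hA hb huv rfl (by omega) (by omega) (by omega) (by omega)
  · obtain ⟨-, h₁, h₂, h₃⟩ := card_crowd_of_ne_Q1 hk
    obtain ⟨w, hw⟩ := Finset.card_pos.1 (by rw [h₂]; norm_num)
    obtain ⟨hw, hwb⟩ := mem_crowd.1 hw
    have key : ∀ x : Vertex n, x.1 = v.1 → (x ∈ A ↔ w ∈ A) := by
      intro x hx
      have hx' := Kind.dist_of_ne_Q1 (κ := x.1.kind) (by rw [hx]; exact hk) x.2.1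
      by_cases hb : (x.2.1 : ℕ) ≤ 2
      · exact φ.mem_iff_of_crowd hε hε' hA h₁.ge hx hw (by omega) (by omega) (by omega) (by omega)
      · exact φ.mem_iff_of_crowd hε hε' hA h₃.ge hx hw (by omega) (by omega) (by omega) (by omega)
    exact (key u huv).trans (key v rfl).symm

/-- The facing n³-crowds form a complete bipartite graph with n⁶ edges, too many to cut. -/
theorem MonotoneXor.mem_iff_of_col_eq_add_one {u v : Vertex n} (hu : u.1.kind = .Q1)
    (hv : v.1.kind = .Q1) (hrow : u.1.row = v.1.row) (hcol : v.1.col = u.1.col + 1) :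
    u ∈ A ↔ v ∈ A := by
  have hadj : ∀ x ∈ crowd u.1 2, ∀ y ∈ crowd v.1 0, (φ.graphH ε).Adj x y := by
    intro x hx y hy
    obtain ⟨hx, hbx⟩ := mem_crowd.1 hx
    obtain ⟨hy, hby⟩ := mem_crowd.1 hy
    exact φ.adj_of_col_eq_add_one hε hε' (hx ▸ hu) (hy ▸ hv) (by rw [hx, hy, hrow])
      (by rw [hx, hy, hcol]) hbx hby
  have hcard : (crowd u.1 2).card * (crowd v.1 0).card = n ^ 6 := by
    rw [(card_crowd_of_eq_Q1 hu).2.2, (card_crowd_of_eq_Q1 hv).1]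
    ring
  have hux : ∀ x ∈ crowd u.1 2, x ∈ A ↔ u ∈ A := fun x hx =>
    φ.mem_iff_of_same_gadget hε hε' hn hA (mem_crowd.1 hx).1
  have hvy : ∀ y ∈ crowd v.1 0, y ∈ A ↔ v ∈ A := fun y hy =>
    φ.mem_iff_of_same_gadget hε hε' hn hA (mem_crowd.1 hy).1
  by_contra hne
  by_cases huA : u ∈ A
  · have hvA : v ∉ A := fun h => hne ⟨fun _ => h, fun _ => huA⟩
    have := card_mul_card_le_cutSize (fun x hx => (hux x hx).2 huA)
      (fun y hy => (hvy y hy).not.2 hvA) hadj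
    omega
  · have hvA : v ∈ A := by
      by_contra h
      exact hne ⟨fun h' => absurd h' huA, fun h' => absurd h' h⟩
    have := card_mul_card_le_cutSize (fun y hy => (hvy y hy).2 hvA)
      (fun x hx => (hux x hx).not.2 huA) (fun y hy x hx => (hadj x hx y hy).symm)
    rw [mul_comm] at this
    omega

/-- The last n⁶-crowd of the lower gadget is also adjacent to the first disk of the upper one. -/
theorem MonotoneXor.mem_iff_of_row_eq_add_one {u v : Vertex n} (hu : u.1.kind ≠ .Q1)
    (hv : v.1.kind ≠ .Q1) (hcol : u.1.col = v.1.col) (hrow : v.1.row = u.1.row + 1) :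
    u ∈ A ↔ v ∈ A := by
  have h₃ := (card_crowd_of_ne_Q1 hu).2.2.2
  obtain ⟨x, hx⟩ := Finset.card_pos.1 (by rw [h₃]; positivity)
  obtain ⟨y, hy⟩ := Finset.card_pos.1
    (by rw [(card_crowd_of_ne_Q1 hv).1]; norm_num : 0 < (crowd v.1 0).card)
  obtain ⟨hx, hxb⟩ := mem_crowd.1 hx
  obtain ⟨hy, hyb⟩ := mem_crowd.1 hy
  rw [← φ.mem_iff_of_same_gadget hε hε' hn hA hx, ← φ.mem_iff_of_same_gadget hε hε' hn hA hy]
  refine φ.mem_iff_of_common hA h₃.ge fun w hw => ?_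
  obtain ⟨hw, hwb⟩ := mem_crowd.1 hw
  refine ⟨fun h => φ.adj_of_same_gadget hε hε' h.symm (hx.trans hw.symm) (by omega) (by omega),
    fun _ => (φ.adj_of_row_eq_add_one hε hε' (hw ▸ hu) (hy ▸ hv) ?_ ?_ hwb hyb).symm⟩
  · rw [hw, hy, hcol]
  · rw [hw, hy, hrow]

theorem MonotoneXor.mem_iff_of_bend {u v : Vertex n} (hu : u.1.kind = .Q1)
    (hv : v.1.kind = .Q3) (hrow : u.1.row = v.1.row) (hcol : v.1.col = u.1.col + 1) :
    u ∈ A ↔ v ∈ A := by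
  have h₁ := (card_crowd_of_ne_Q1 (g := v.1) (by simp [hv])).2.1
  obtain ⟨x, hx⟩ := Finset.card_pos.1
    (by rw [(card_crowd_of_eq_Q1 hu).2.2]; positivity : 0 < (crowd u.1 2).card)
  obtain ⟨y, hy⟩ := Finset.card_pos.1 (by rw [h₁]; positivity)
  obtain ⟨hx, hxb⟩ := mem_crowd.1 hx
  obtain ⟨hy, hyb⟩ := mem_crowd.1 hy
  rw [← φ.mem_iff_of_same_gadget hε hε' hn hA hx, ← φ.mem_iff_of_same_gadget hε hε' hn hA hy]
  refine φ.mem_iff_of_common hA h₁.ge fun w hw => ?_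
  obtain ⟨hw, hwb⟩ := mem_crowd.1 hw
  refine ⟨fun _ => φ.adj_of_bend hε hε' (hx ▸ hu) (hw ▸ hv) ?_ ?_ hxb hwb,
    fun h => φ.adj_of_same_gadget hε hε' h.symm (hy.trans hw.symm) (by omega) (by omega)⟩
  · rw [hw, hx, hrow]
  · rw [hw, hx, hcol]

theorem MonotoneXor.mem_iff_of_horizontal (m : ℕ) : ∀ {u v : Vertex n} (_ : u.1.kind = .Q1)
    (_ : v.1 = .bend u.1.trackIndex.1 u.1.trackIndex.2)
    (_ : u.1.col + m + 1 = bendCol u.1.trackIndex), u ∈ A ↔ v ∈ A := by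
  induction m with
  | zero =>
    intro u v hu hv hm
    refine φ.mem_iff_of_bend hε hε' hn hA hu (by rw [hv]; rfl) ?_ ?_
    · rw [hv, Gadget.row_eq hu]; rfl
    · rw [hv]
      change bendCol u.1.trackIndex = u.1.col + 1
      push_cast at hm
      omega
  | succ m ih =>
    intro u v hu hv hm
    push_cast at hm
    have hs := Gadget.startCol_le_col hu
    obtain ⟨g, hg, hgt, hgc⟩ := Gadget.exists_of_col (t := u.1.trackIndex) (x := u.1.col + 1)
      (by omega) (by omega)
    obtain ⟨w, rfl⟩ := Gadget.exists_vertex hn g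
    rw [φ.mem_iff_of_col_eq_add_one hε hε' hn hA hu hg
      (by rw [Gadget.row_eq hu, Gadget.row_eq hg, hgt]) hgc]
    exact ih hg (by rw [hgt]; exact hv) (by rw [hgt]; omega)

theorem MonotoneXor.mem_iff_of_vertical (m : ℕ) : ∀ {u v : Vertex n} (_ : u.1.kind ≠ .Q1)
    (_ : v.1 = .bend u.1.trackIndex.1 u.1.trackIndex.2)
    (_ : u.1.row = bendRow u.1.trackIndex + m), u ∈ A ↔ v ∈ A := by
  induction m with
  | zero =>
    intro u v hu hv hm
    refine φ.mem_iff_of_same_gadget hε hε' hn hA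
      (Gadget.eq_of_row_eq hu (by rw [hv]; simp [Gadget.kind]) (by rw [hv]; rfl) ?_)
    rw [hv, hm]
    simp [Gadget.row]
  | succ m ih =>
    intro u v hu hv hm
    push_cast at hm
    have hs := Gadget.row_lt hu
    obtain ⟨g, hg, hgt, hgr⟩ := Gadget.exists_of_row (t := u.1.trackIndex) (y := u.1.row - 1)
      (by omega) (by omega)
    obtain ⟨w, rfl⟩ := Gadget.exists_vertex hn g
    rw [← φ.mem_iff_of_row_eq_add_one hε hε' hn hA hg hu
      (by rw [Gadget.col_eq hu, Gadget.col_eq hg, hgt]) (by omega)]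
    exact ih hg (by rw [hgt]; exact hv) (by rw [hgt]; omega)

/-- A sufficiently small cut does not separate two disks of the same track. -/
theorem MonotoneXor.mem_iff_of_same_track {u v : Vertex n}
    (huv : u.1.trackIndex = v.1.trackIndex) : u ∈ A ↔ v ∈ A := by
  obtain ⟨w, hw⟩ := Gadget.exists_vertex hn (.bend v.1.trackIndex.1 v.1.trackIndex.2)
  have key : ∀ x : Vertex n, x.1.trackIndex = v.1.trackIndex → (x ∈ A ↔ w ∈ A) := by
    intro x hx
    rw [← hx] at hw
    by_cases hk : x.1.kind = .Q1
    · have := Gadget.col_lt hk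
      exact φ.mem_iff_of_horizontal hε hε' hn hA (bendCol x.1.trackIndex - x.1.col - 1).toNat hk hw
        (by omega)
    · have := Gadget.le_row hk
      exact φ.mem_iff_of_vertical hε hε' hn hA (x.1.row - bendRow x.1.trackIndex).toNat hk hw
        (by omega)
  exact (key u huv).trans (key v rfl).symm

end Monochromatic

/-! ## Bisections and colourings of the tracks -/

theorem Kind.sum_size (n : ℕ) (κ : Kind) : ∑ b, κ.size n b = 2 * n ^ 6 + 2 := by
  have h : n ^ 3 ≤ n ^ 6 := by
    rcases Nat.eq_zero_or_pos n with rfl | hn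
    · simp
    · exact Nat.pow_le_pow_right hn (by norm_num)
  cases κ
  · change ∑ b : Fin 3, _ = _
    simp only [Fin.sum_univ_three, Kind.size, Matrix.cons_val]
    omega
  all_goals
    change ∑ b : Fin 4, _ = _
    simp only [Fin.sum_univ_four, Kind.size, Matrix.cons_val]
    omega

theorem card_filter_trackIndex (f : TrackIndex n → Bool) :
    (Finset.univ.filter fun v : Vertex n => f v.1.trackIndex = true).card =
      (Finset.univ.filter fun t => f t = true).card * ((2 * n + 2) * (2 * n ^ 6 + 2)) := by
  have h₁ : (Finset.univ.filter fun v : Vertex n => f v.1.trackIndex = true) =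
      (Finset.univ.filter fun g : Gadget n => f g.trackIndex = true).sigma
        fun _ => Finset.univ := by
    ext v
    simp
  have h₂ : (Finset.univ.filter fun g : Gadget n => f g.trackIndex = true).card =
      (Finset.univ.filter fun t => f t = true).card * (2 * n + 2) := by
    rw [Finset.card_eq_sum_card_fiberwise (f := Gadget.trackIndex)
      (t := Finset.univ.filter fun t => f t = true) (fun g hg => by simpa using hg)]
    refine Finset.sum_const_nat fun t ht => ?_
    rw [Finset.filter_filter, ← Gadget.card_trackIndex_eq t]
    congr 1
    ext g
    simp only [Finset.mem_filter, Finset.mem_univ, true_and, and_iff_right_iff_imp] at ht ⊢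
    rintro rfl
    exact ht
  rw [h₁, Finset.card_sigma, ← mul_assoc, ← h₂]
  refine Finset.sum_const_nat fun g _ => ?_
  simp [Kind.sum_size]

theorem card_vertex (n : ℕ) :
    Fintype.card (Vertex n) = 2 * (n * ((2 * n + 2) * (2 * n ^ 6 + 2))) := by
  have := card_filter_trackIndex (n := n) fun _ => true
  simp only [Finset.filter_true, Finset.card_univ, Fintype.card_prod, Fintype.card_fin] at this
  rw [this]
  ring

theorem isBisection_iff (hn : 0 < n) {f : TrackIndex n → Bool} {A : Finset (Vertex n)}
    (hA : ∀ v, v ∈ A ↔ f v.1.trackIndex = true) :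
    IsBisection A ↔ (Finset.univ.filter fun t => f t = true).card = n := by
  classical
  set W := (2 * n + 2) * (2 * n ^ 6 + 2) with hW
  set T := (Finset.univ.filter fun t => f t = true).card with hT
  have hAT : A.card = T * W := by
    rw [hT, hW, ← card_filter_trackIndex]
    congr 1
    ext v
    simp [hA]
  have hceil : ⌈(Fintype.card (Vertex n) : ℚ) / 2⌉₊ = n * W := by
    rw [card_vertex, ← hW, Nat.cast_mul, Nat.cast_ofNat, mul_div_cancel_left₀ _ (by norm_num),
      Nat.ceil_natCast]
  have hWpos : 0 < W := by positivity
  have hcompl : A.card + Aᶜ.card = 2 * (n * W) := by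
    rw [Finset.card_add_card_compl, card_vertex]
  have hbis : IsBisection A ↔ A.card ≤ n * W ∧ Aᶜ.card ≤ n * W := by
    rw [IsBisection, hceil]
    congr!
  rw [hbis]
  constructor
  · rintro ⟨h₁, h₂⟩
    exact Nat.eq_of_mul_eq_mul_right hWpos (by omega)
  · rintro h
    rw [h] at hAT
    omega

/-- The tracks of different variables that are coloured differently. -/
def bichromaticPairs (f : TrackIndex n → Bool) : Finset (TrackIndex n × TrackIndex n) :=
  Finset.univ.filter fun t => t.1.1 < t.2.1 ∧ f t.1 ≠ f t.2

/-- The variables whose two tracks are coloured differently. -/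
def splitVariables (f : TrackIndex n → Bool) : Finset (Fin n) :=
  Finset.univ.filter fun i => f (i, 0) ≠ f (i, 1)

/-- There are n · n pairs (true track, false track); they are sorted by whether both tracks belong
to the same variable. -/
theorem card_bichromaticPairs_add (f : TrackIndex n → Bool)
    (hf : (Finset.univ.filter fun t => f t = true).card = n) :
    (bichromaticPairs f).card + (splitVariables f).card = n ^ 2 := by
  have hf' : (Finset.univ.filter fun t => ¬ f t = true).card = n := by
    have := Finset.card_filter_add_card_filter_not (s := (Finset.univ : Finset (TrackIndex n)))
      (fun t => f t = true)
    simp only [Finset.card_univ, Fintype.card_prod, Fintype.card_fin] at this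
    omega
  have hR : (Finset.univ.filter fun t : TrackIndex n × TrackIndex n =>
      f t.1 = true ∧ ¬ f t.2 = true).card = n ^ 2 := by
    have := Finset.filter_product (s := Finset.univ) (t := Finset.univ)
      (fun t : TrackIndex n => f t = true) (fun t : TrackIndex n => ¬ f t = true)
    rw [Finset.univ_product_univ] at this
    rw [this, Finset.card_product, hf, hf', sq]
  rw [← hR, ← Finset.card_filter_add_card_filter_not
      (s := Finset.univ.filter fun t : TrackIndex n × TrackIndex n =>
        f t.1 = true ∧ ¬ f t.2 = true) (fun t => t.1.1 = t.2.1), add_comm,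
    Finset.filter_filter, Finset.filter_filter]
  congr 1
  · refine (Finset.card_nbij (fun t => t.1.1) ?_ ?_ ?_).symm
    · rintro ⟨⟨i, j⟩, ⟨k, l⟩⟩ h
      simp only [Finset.coe_filter, Finset.mem_univ, true_and, Set.mem_ofPred_eq] at h
      obtain ⟨⟨h₁, h₂⟩, rfl⟩ := h
      simp only [splitVariables, Finset.coe_filter, Finset.mem_univ, true_and, Set.mem_ofPred_eq]
      fin_cases j <;> fin_cases l <;> simp_all
    · rintro ⟨⟨i, j⟩, ⟨k, l⟩⟩ h ⟨⟨i', j'⟩, ⟨k', l'⟩⟩ h' (rfl : i = i')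
      simp only [Finset.coe_filter, Finset.mem_univ, true_and, Set.mem_ofPred_eq] at h h'
      obtain ⟨⟨h₁, h₂⟩, rfl⟩ := h
      obtain ⟨⟨h₁', h₂'⟩, rfl⟩ := h'
      fin_cases j <;> fin_cases l <;> fin_cases j' <;> fin_cases l' <;> simp_all
    · intro i hi
      simp only [splitVariables, Finset.coe_filter, Finset.mem_univ, true_and,
        Set.mem_ofPred_eq] at hi
      cases h0 : f (i, 0)
      · exact ⟨((i, 1), (i, 0)), by simpa [h0] using hi, rfl⟩
      · exact ⟨((i, 0), (i, 1)), by simpa [h0] using hi, rfl⟩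
  · refine (Finset.card_nbij' (fun t => if t.1.1 < t.2.1 then t else t.swap)
      (fun t => if f t.1 = true then t else t.swap) ?_ ?_ ?_ ?_).symm
    · rintro ⟨a, b⟩ h
      simp only [Finset.coe_filter, Finset.mem_univ, true_and, Set.mem_ofPred_eq,
        Bool.not_eq_true] at h
      obtain ⟨⟨h₁, h₂⟩, hne⟩ := h
      by_cases hlt : a.1 < b.1
      · simp [bichromaticPairs, hlt, h₁, h₂]
      · simp [bichromaticPairs, hlt, h₁, h₂, lt_of_le_of_ne (not_lt.1 hlt) (Ne.symm hne)]
    · rintro ⟨a, b⟩ h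
      simp only [bichromaticPairs, Finset.coe_filter, Finset.mem_univ, true_and,
        Set.mem_ofPred_eq] at h
      obtain ⟨hlt, hne⟩ := h
      cases h0 : f a
      · have h1 : f b = true := by simpa [h0] using hne
        simp [h0, h1, hlt.ne']
      · have h1 : f b = false := by simpa [h0] using hne
        simp [h0, h1, hlt.ne]
    · rintro ⟨a, b⟩ h
      simp only [Finset.coe_filter, Finset.mem_univ, true_and, Set.mem_ofPred_eq,
        Bool.not_eq_true] at h
      obtain ⟨⟨h₁, h₂⟩, hne⟩ := h
      by_cases hlt : a.1 < b.1 <;> simp [hlt, h₁, h₂]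
    · rintro ⟨a, b⟩ h
      simp only [bichromaticPairs, Finset.coe_filter, Finset.mem_univ, true_and,
        Set.mem_ofPred_eq] at h
      obtain ⟨hlt, hne⟩ := h
      by_cases h0 : f a = true <;> simp [h0, hlt, hlt.not_gt]

/-- The differently coloured pairs of tracks whose crossing is modified. -/
def MonotoneXor.modifiedPairs (φ : MonotoneXor n) (f : TrackIndex n → Bool) :
    Finset (TrackIndex n × TrackIndex n) :=
  (bichromaticPairs f).filter fun t => (t.1.1, t.2.1) ∈ φ.clauses ∧ t.1.2 ≠ t.2.2

theorem MonotoneXor.cutSize_eq (φ : MonotoneXor n) {ε : ℝ} (hε : 0 < ε)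
    (hε' : ε < 1 / 1000) (f : TrackIndex n → Bool) (A : Finset (Vertex n))
    (hA : ∀ v, v ∈ A ↔ f v.1.trackIndex = true) :
    cutSize (φ.graphH ε) A =
      (bichromaticPairs f).card * (2 * n ^ 3) + (φ.modifiedPairs f).card := by
  rw [φ.cutSize_eq_sum hε hε' f A hA, ← Finset.sum_filter, Finset.sum_add_distrib,
    Finset.sum_const, smul_eq_mul, modifiedPairs, ← Finset.card_filter, bichromaticPairs]

/-- With opposite colours on T_{i,0} and T_{i,1}, the tracks T_{i,j} and T_{k,1-j} differ exactly
when `f (i, 0) = f (k, 0)`, so each violated clause counts once for each j. -/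
theorem MonotoneXor.card_modifiedPairs_add (φ : MonotoneXor n) {f : TrackIndex n → Bool}
    (hf : ∀ i, f (i, 0) ≠ f (i, 1)) :
    (φ.modifiedPairs f).card + 2 * φ.numSat (fun i => f (i, 0)) = 2 * φ.clauses.card := by
  have hf' : ∀ i, f (i, 1) = !f (i, 0) := fun i => by
    have := hf i
    cases h0 : f (i, 0) <;> cases h1 : f (i, 1) <;>
      simp_all only [ne_eq, not_true_eq_false] <;> rfl
  have h : (φ.modifiedPairs f).card =
      ((φ.clauses.filter fun c => ¬ f (c.1, 0) ≠ f (c.2, 0)) ×ˢ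
        (Finset.univ : Finset (Fin 2))).card := by
    refine Finset.card_nbij' (fun t => ((t.1.1, t.2.1), t.1.2))
      (fun p => ((p.1.1, p.2), (p.1.2, p.2.rev))) ?_ ?_ ?_ ?_
    · rintro ⟨⟨i, j⟩, ⟨k, l⟩⟩ h
      simp only [modifiedPairs, bichromaticPairs, Finset.coe_filter, Finset.mem_filter,
        Finset.mem_univ, true_and, Set.mem_ofPred_eq] at h
      obtain ⟨⟨-, h₁⟩, h₂, h₃⟩ := h
      simp only [Finset.coe_product, Set.mem_prod, Finset.coe_filter, Set.mem_ofPred_eq, h₂,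
        true_and, Finset.coe_univ, Set.mem_univ, and_true]
      fin_cases j <;> fin_cases l <;> simp_all
    · rintro ⟨⟨i, k⟩, j⟩ h
      simp only [Finset.coe_product, Set.mem_prod, Finset.coe_filter, Set.mem_ofPred_eq,
        Finset.coe_univ, Set.mem_univ, and_true, not_not] at h
      have hlt := φ.fst_lt_snd _ h.1
      simp only [modifiedPairs, bichromaticPairs, Finset.coe_filter, Finset.mem_filter,
        Finset.mem_univ, true_and, Set.mem_ofPred_eq]
      refine ⟨⟨hlt, ?_⟩, h.1, ?_⟩ <;> fin_cases j <;> simp [hf', h.2, Fin.rev]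
    · rintro ⟨⟨i, j⟩, ⟨k, l⟩⟩ h
      simp only [modifiedPairs, bichromaticPairs, Finset.coe_filter, Finset.mem_filter,
        Finset.mem_univ, true_and, Set.mem_ofPred_eq] at h
      obtain ⟨-, -, h₃⟩ := h
      fin_cases j <;> fin_cases l <;> simp_all [Fin.rev]
    · intro p _
      rfl
  have h' := Finset.card_filter_add_card_filter_not (s := φ.clauses)
    (fun c => f (c.1, 0) ≠ f (c.2, 0))
  rw [h, Finset.card_product, Finset.card_univ, Fintype.card_fin, numSat]
  omega

end XorBisection

/-! ### The equivalence -/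

open XorBisection in
theorem theorem1 :
    ∃ ε₀ : ℝ, 0 < ε₀ ∧
      ∀ (n : ℕ) (φ : XorBisection.MonotoneXor n), φ.IsXor 3 → 2 * φ.clauses.card = 3 * n →
        ∀ ε : ℝ, 0 < ε → ε < ε₀ → ∀ k : ℕ,
          (∃ τ : Fin n → Bool, k ≤ φ.numSat τ) ↔
            ∃ A : Finset (XorBisection.Vertex n), XorBisection.IsBisection A ∧
              (XorBisection.cutSize (φ.graphH ε) A : ℤ) ≤
                2 * (n : ℤ) ^ 4 * ((n : ℤ) - 1) + 3 * (n : ℤ) - 2 * (k : ℤ) := by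
  refine ⟨1 / 1000, by norm_num, fun n φ _ hm ε hε hε' k => ?_⟩
  rcases Nat.eq_zero_or_pos n with rfl | hpos
  · have h0 : φ.clauses = ∅ := Finset.card_eq_zero.1 (by omega)
    refine ⟨fun ⟨τ, hτ⟩ => ⟨∅, ?_, ?_⟩, fun ⟨A, _, hA⟩ => ⟨fun _ => true, ?_⟩⟩
    · have := card_vertex 0
      simp only [zero_mul, mul_zero] at this
      simp [IsBisection, this]
    · have hk : k = 0 := by simpa [MonotoneXor.numSat, h0] using hτ
      simp [cutSize, hk]
    · simp only [Nat.cast_zero] at hA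
      omega
  -- 3n = 2m is even, which excludes n = 1.
  have hn : 2 ≤ n := by omega
  constructor
  · rintro ⟨τ, hτ⟩
    let f : TrackIndex n → Bool := fun t => if t.2 = 0 then τ t.1 else !τ t.1
    have hf : ∀ i, f (i, 0) ≠ f (i, 1) := fun i => by simp [f]
    have hS : (splitVariables f).card = n := by
      simp [splitVariables, hf]
    have hT : (Finset.univ.filter fun t => f t = true).card = n := by
      refine (Finset.card_nbij (t := Finset.univ) Prod.fst (by simp) ?_ ?_).trans
        (Finset.card_fin n)
      · rintro ⟨i, j⟩ h ⟨i', j'⟩ h' (rfl : i = i')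
        simp only [Finset.coe_filter, Finset.mem_univ, true_and, Set.mem_ofPred_eq, f] at h h'
        fin_cases j <;> fin_cases j' <;> simp_all
      · intro i _
        cases hi : τ i
        · exact ⟨(i, 1), by simp [f, hi], rfl⟩
        · exact ⟨(i, 0), by simp [f, hi], rfl⟩
    have hA : ∀ v : Vertex n, v ∈ (Finset.univ.filter fun v : Vertex n =>
        f v.1.trackIndex = true) ↔ f v.1.trackIndex = true := by simp
    refine ⟨_, (isBisection_iff hpos hA).2 hT, ?_⟩
    have h₁ := card_bichromaticPairs_add f hT
    have h₂ := φ.card_modifiedPairs_add hf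
    rw [φ.cutSize_eq hε hε' f _ hA]
    have h₃ : φ.numSat (fun i => f (i, 0)) = φ.numSat τ := rfl
    rw [hS] at h₁
    rw [h₃] at h₂
    zify at h₁ h₂ hm hτ ⊢
    rw [← eq_sub_iff_add_eq] at h₁
    rw [h₁]
    linarith
  · rintro ⟨A, hA, hcut⟩
    -- From 3n + 2 < n⁴ the left side is below 2n⁵ - n⁴, which is at most n⁶ because n⁴(n-1)² ≥ 0.
    have hsmall : cutSize (φ.graphH ε) A + 2 < n ^ 6 := by
      have hn' : (2 : ℤ) ≤ n := by exact_mod_cast hn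
      have h₁ : (0 : ℤ) ≤ n ^ 4 * (n - 1) ^ 2 := by positivity
      have h₂ : (3 * n + 2 : ℤ) < n ^ 4 := by
        have : (4 : ℤ) ≤ n ^ 2 := by nlinarith
        nlinarith [mul_le_mul this this (by norm_num) (by positivity)]
      zify
      linarith
    classical
    let f : TrackIndex n → Bool := fun t => decide (∃ v ∈ A, v.1.trackIndex = t)
    have hf : ∀ v, v ∈ A ↔ f v.1.trackIndex = true := by
      intro v
      simp only [f, decide_eq_true_eq]
      refine ⟨fun h => ⟨v, h, rfl⟩, ?_⟩
      rintro ⟨w, hw, h⟩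
      exact (φ.mem_iff_of_same_track hε hε' hn hsmall h).1 hw
    have hT := (isBisection_iff hpos hf).1 hA
    have h₁ := card_bichromaticPairs_add f hT
    rw [φ.cutSize_eq hε hε' f A hf] at hcut
    -- One unsplit variable forces an additional bichromatic crossing, whose 2n³ edges exceed the
    -- slack 3n.
    have hS : (splitVariables f).card = n := by
      have hle : (splitVariables f).card ≤ n := by
        simpa using Finset.card_le_univ (splitVariables f)
      by_contra hne
      have hlt : (splitVariables f).card + 1 ≤ n := by omega
      have h₂ : n ^ 2 + 1 ≤ (bichromaticPairs f).card + n := by omega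
      have hn' : (2 : ℤ) ≤ n := by exact_mod_cast hn
      have h₃ : (3 * n : ℤ) < 2 * n ^ 3 := by nlinarith [mul_le_mul hn' hn' (by norm_num) (by omega)]
      zify at h₂
      have h₄ := mul_le_mul_of_nonneg_right h₂ (by positivity : (0 : ℤ) ≤ 2 * n ^ 3)
      push_cast at hcut
      linarith
    have hsplit : ∀ i, f (i, 0) ≠ f (i, 1) := by
      have := Finset.eq_univ_of_card (splitVariables f) (by simpa using hS)
      intro i
      have hi : i ∈ splitVariables f := this ▸ Finset.mem_univ i
      simpa [splitVariables] using hi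
    have h₂ := φ.card_modifiedPairs_add hsplit
    refine ⟨fun i => f (i, 0), ?_⟩
    rw [hS] at h₁
    zify at h₁ h₂ hm hcut ⊢
    rw [← eq_sub_iff_add_eq] at h₁
    rw [h₁] at hcut
    linarith
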